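/- Let $(\mathbb X,\mathcal X)$ be a countably separated measurable space (for instance any standard Borel space), $H$ a nonatomic probability measure on it ($H(\{x\})=0$ for all $x$), and $\alpha,\tau,\varphi>0$. Write $\mathrm{Gamma}(a,r)$ for the gamma law with shape $a$ and inverse scale $r$, with $\mathrm{Gamma}(0,r)=\delta_0$. A random measure $G$ is a gamma process, $G\sim\Gamma(\alpha,\tau,H)$, if it is a random atomic measure $\sum_k w_k\delta_{X_k}$ whose masses on disjoint measurable sets are independent and $G(A)\sim\mathrm{Gamma}(\alpha H(A),\tau)$ for every measurable $A$. Proposition. Let $G_0=\sum_{k\ge1} w_{0k}\delta_{X_k}\sim\Gamma(\alpha,\tau,H)$ and $U_j=\sum_{k\ge1}u_{jk}\delta_{X_k}$, where, given $(w_{0k},X_k)_{k\ge1}$, the $u_{jk}$ are independent with $u_{jk}\sim\mathrm{Poisson}(\varphi w_{0k})$. Then there is a regular conditional distribution of $G_0$ given the random measure $U_j$ which, almost surely, is the law of $$G_0^*+\sum_{k\ge1}w_{0k}^*\,\delta_{X_k},$$ where, conditionally on $U_j$ (with the $X_k$ and $u_{jk}$ in this expression held fixed), $G_0^*$ and $(w^*_{0k})_{k\ge1}$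 are mutually independent, $G_0^*\sim\Gamma(\alpha,\tau+\varphi,H)$ and $w_{0k}^*\sim\mathrm{Gamma}(u_{jk},\tau+\varphi)$; in particular $w_{0k}^*=0$ when $u_{jk}=0$. Moreover, almost surely only finitely many $u_{jk}$ are positive, and $G_0^*(\mathbb X)\sim\mathrm{Gamma}(\alpha,\tau+\varphi)$. Under the posterior, almost surely, $\sum_k w^*_{0k}\delta_{X_k}$ has exactly the (finitely many) atoms of $U_j$, while $G_0^*$ has infinitely many atoms, none of which is an atom of $U_j$. -/

import Mathlib

open MeasureTheory ProbabilityTheory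
open scoped NNReal ENNReal

universe u v

/-- The law `Gamma(a, r)` (shape `a`, inverse scale `r`) on `[0, ∞)`, with the convention that
`Gamma(0, r)` is the point mass at `0`. -/
noncomputable def gammaLaw (a r : ℝ) : Measure ℝ≥0 :=
  if a = 0 then Measure.dirac 0 else (gammaMeasure a r).map Real.toNNReal

/-- The atomic measure `∑ₖ wₖ δ_{xₖ}`. -/
noncomputable def atomicMeasure {𝓧 : Type v} [MeasurableSpace 𝓧]
    (w : ℕ → ℝ≥0) (x : ℕ → 𝓧) : Measure 𝓧 :=
  Measure.sum fun k => (w k : ℝ≥0∞) • Measure.dirac (x k)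

/-- The set of atoms of a measure. -/
def atomSet {𝓧 : Type v} [MeasurableSpace 𝓧] (μ : Measure 𝓧) : Set 𝓧 :=
  {x | 0 < μ {x}}

/-- `G` is a gamma process `Γ(α, τ, H)` under the probability measure `P`: a random atomic measure
which is completely random (independent masses on disjoint sets) and has gamma marginals
`G(A) ∼ Gamma(α H(A), τ)`. -/
structure IsGammaProcess {Ω : Type u} [MeasurableSpace Ω] {𝓧 : Type v} [MeasurableSpace 𝓧]
    (G : Ω → Measure 𝓧) (α τ : ℝ) (H : Measure 𝓧) (P : Measure Ω) : Prop where
  measurable : Measurable G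
  atomic : ∃ (w : ℕ → Ω → ℝ≥0) (X : ℕ → Ω → 𝓧), (∀ k, Measurable (w k)) ∧
    (∀ k, Measurable (X k)) ∧ ∀ᵐ ω ∂P, G ω = atomicMeasure (w · ω) (X · ω)
  indep : ∀ (n : ℕ) (A : Fin n → Set 𝓧), (∀ i, MeasurableSet (A i)) →
    Pairwise (Function.onFun Disjoint A) → iIndepFun (fun i ω => G ω (A i)) P
  marginal : ∀ A : Set 𝓧, MeasurableSet A →
    HasLaw (fun ω => G ω A) ((gammaLaw (α * H.real A) τ).map ((↑) : ℝ≥0 → ℝ≥0∞)) P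

/-- Given the masses and locations `(wₖ, Xₖ)ₖ`, the counts `uₖ` are independent with
`uₖ ∼ Poisson(φ wₖ)`: their conditional finite-dimensional laws are products of Poisson laws. -/
def IsCondPoisson {Ω : Type u} [MeasurableSpace Ω] {𝓧 : Type v} [MeasurableSpace 𝓧]
    (u : ℕ → Ω → ℕ) (w : ℕ → Ω → ℝ≥0) (X : ℕ → Ω → 𝓧) (φ : ℝ) (P : Measure Ω) : Prop :=
  (∀ k, Measurable (u k)) ∧ ∀ (s : Finset ℕ) (m : ℕ → ℕ),
    P⟦{ω | ∀ k ∈ s, u k ω = m k} |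
        MeasurableSpace.comap (fun ω k => (w k ω, X k ω)) inferInstance⟧
      =ᵐ[P] fun ω => ∏ k ∈ s, (poissonMeasure (φ.toNNReal * w k ω)).real {m k}

/-- On some probability space there are a gamma process `G' ∼ Γ(α, τ', H)` and masses
`w'ₖ ∼ Gamma(nₖ, τ')`, all mutually independent, such that `G' + ∑ₖ w'ₖ δ_{xₖ}` has law `ρ`.
The part `∑ₖ w'ₖ δ_{xₖ}` has a.s. the same atoms as `∑ₖ nₖ δ_{xₖ}`, finitely many, and `G'` has
a.s. infinitely many atoms, none of them shared. -/
def IsGammaPosterior {𝓧 : Type v} [MeasurableSpace 𝓧] (ρ : Measure (Measure 𝓧))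
    (α τ' : ℝ) (H : Measure 𝓧) (n : ℕ → ℕ) (x : ℕ → 𝓧) : Prop :=
  ∃ (Ω' : Type u) (_ : MeasurableSpace Ω') (Q : Measure Ω') (_ : IsProbabilityMeasure Q)
    (G' : Ω' → Measure 𝓧) (w' : ℕ → Ω' → ℝ≥0),
    IsGammaProcess G' α τ' H Q ∧
    (∀ k, HasLaw (w' k) (gammaLaw (n k) τ') Q) ∧
    iIndepFun w' Q ∧
    IndepFun G' (fun ω' k => w' k ω') Q ∧
    HasLaw (fun ω' => G' ω' + atomicMeasure (w' · ω') x) ρ Q ∧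
    HasLaw (fun ω' => G' ω' Set.univ) ((gammaLaw α τ').map ((↑) : ℝ≥0 → ℝ≥0∞)) Q ∧
    (atomSet (atomicMeasure (fun k => (n k : ℝ≥0)) x)).Finite ∧
    ∀ᵐ ω' ∂Q,
      atomSet (atomicMeasure (w' · ω') x) = atomSet (atomicMeasure (fun k => (n k : ℝ≥0)) x) ∧
      (atomSet (G' ω')).Infinite ∧
      Disjoint (atomSet (G' ω')) (atomSet (atomicMeasure (fun k => (n k : ℝ≥0)) x))

/-! Fix disjoint measurable sets `A j`. Given the masses and locations, `U (A j)` is a sum of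
independent Poisson counts over the atoms lying in `A j`; hence these block counts are independent
Poisson with means `φ G₀(A j)`. The finite-dimensional model is therefore a product of gamma–Poisson
pairs, and conjugacy (`gammaLaw_withDensity_poisson`) makes the masses, given counts `n j`,
independent with laws Gamma(α H(A j) + n j, τ + φ). This is `measure_counts_gamma`.

The proposed posterior, evaluated on the same sets, has masses Gamma(α H(A j), τ + φ) + Gamma(n j, τ
+ φ), all independent. By additivity of gamma laws these are the same distributions
(`map_evalSets_posterior`). A joint law of two random measures is determined by evaluations on
finite disjoint families (`measure_prod_measure_ext`), so the two descriptions agree as conditional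
distributions.

A further point is measurability: the proposed law is written with `u` and `X`, but must be a kernel
in `U` alone. An urn scheme provides this. Draw an atom from the normalized measure, remove one unit
of its mass, attach an independent Gamma(1, r) mass to it, and repeat until the mass is exhausted.
Whatever the draws, an atom with count n receives n such increments, hence a Gamma(n, r) mass in
total.

The process Γ(α, τ + φ, H) is obtained by rescaling `G₀`. It has infinitely many atoms because it
charges all H-positive cylinders of a countable separating family, while a finite set is H-null; it
misses each atom of `U` because singletons are H-null. -/

/-! ### Convolution of product measures and sums over disjoint blocks. -/

theorem pi_conv_pi {J M : Type*} [Fintype J] [AddMonoid M] [MeasurableSpace M] [MeasurableAdd₂ M]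
    (μ ν : J → Measure M) [∀ j, IsProbabilityMeasure (μ j)] [∀ j, IsProbabilityMeasure (ν j)] :
    (Measure.pi μ) ∗ (Measure.pi ν) = Measure.pi fun j => μ j ∗ ν j := by
  symm
  refine Measure.pi_eq fun s hs => ?_
  have hadd : Measurable fun p : (J → M) × (J → M) => p.1 + p.2 := by fun_prop
  rw [Measure.conv, Measure.map_apply hadd (.univ_pi hs),
    ← (measurePreserving_arrowProdEquivProdArrow M M J μ ν).measure_preimage_equiv]
  have : (MeasurableEquiv.arrowProdEquivProdArrow M M J) ⁻¹'
      ((fun p : (J → M) × (J → M) => p.1 + p.2) ⁻¹' Set.univ.pi s) =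
      Set.univ.pi fun j => (fun p : M × M => p.1 + p.2) ⁻¹' s j := by
    ext p
    simp only [Set.mem_preimage, Set.mem_univ_pi]
    rfl
  rw [this, Measure.pi_pi]
  exact Finset.prod_congr rfl fun j _ =>
    (Measure.map_apply (by fun_prop) (hs j)).symm

theorem infinitePi_conv_infinitePi {J M : Type*} [AddMonoid M] [MeasurableSpace M]
    [MeasurableAdd₂ M] (μ ν : J → Measure M) [∀ j, IsProbabilityMeasure (μ j)]
    [∀ j, IsProbabilityMeasure (ν j)] :
    ((Measure.infinitePi μ).prod (Measure.infinitePi ν)).map (fun p => p.1 + p.2) =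
      Measure.infinitePi fun j => μ j ∗ ν j := by
  refine Measure.eq_infinitePi _ fun s t ht => ?_
  have h1 : (Set.pi s t : Set (J → M)) = s.restrict ⁻¹' (Set.univ.pi fun j : s => t j) := by
    ext; simp
  have hm : MeasurableSet (Set.univ.pi fun j : s => t j) := .univ_pi fun j => ht j
  have hadd : Measurable fun p : (J → M) × (J → M) => p.1 + p.2 :=
    measurable_pi_lambda _ fun j => by
      simp only [Pi.add_apply]; fun_prop
  have hr : Measurable (s.restrict : (J → M) → (s → M)) := Finset.measurable_restrict s
  rw [h1, ← Measure.map_apply hr hm, Measure.map_map hr hadd]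
  have h2 : (s.restrict ∘ fun p : (J → M) × (J → M) => p.1 + p.2) =
      (fun q : (s → M) × (s → M) => q.1 + q.2) ∘ Prod.map s.restrict s.restrict := rfl
  rw [h2, ← Measure.map_map (by fun_prop) (by fun_prop), ← Measure.map_prod_map _ _ hr hr,
    Measure.infinitePi_map_restrict, Measure.infinitePi_map_restrict]
  have := pi_conv_pi (fun j : s => μ j) (fun j : s => ν j)
  rw [Measure.conv] at this
  rw [this, Measure.pi_pi]
  exact Finset.prod_coe_sort s fun j => (μ j ∗ ν j) (t j)

/-- A random vector with at most one nonconstant coordinate has independent coordinates. -/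
theorem map_ite_eq_infinitePi {J M : Type*} [Zero M] [MeasurableSpace M]
    (ν : Measure M) [IsProbabilityMeasure ν] (c : J → Prop) [DecidablePred c]
    (hc : ∀ i j, c i → c j → i = j) :
    ν.map (fun y j => if c j then y else 0) =
      Measure.infinitePi fun j => if c j then ν else Measure.dirac 0 := by
  have : ∀ j, IsProbabilityMeasure (if c j then ν else Measure.dirac 0) := fun j => by
    split_ifs <;> infer_instance
  refine Measure.eq_infinitePi _ fun s t ht => ?_
  have hm : Measurable fun (y : M) (j : J) => if c j then y else 0 :=
    measurable_pi_lambda _ fun j => by split_ifs <;> fun_prop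
  rw [Measure.map_apply hm (.pi s.countable_toSet fun j _ => ht j)]
  by_cases h : ∃ j ∈ s, c j
  · obtain ⟨j₀, hj₀, hcj⟩ := h
    classical
    rw [← Finset.mul_prod_erase s _ hj₀, if_pos hcj]
    -- All coordinates other than `j₀` are constantly zero: the cylinder event is `y ∈ t j₀` if
    -- every other `t j` contains zero, and empty otherwise.
    by_cases h0 : ∀ j ∈ s.erase j₀, (0 : M) ∈ t j
    · rw [Finset.prod_eq_one, mul_one]
      · congr 1
        ext y
        simp only [Set.mem_preimage, Set.mem_pi, Finset.mem_coe]
        constructor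
        · intro h; simpa [hcj] using h j₀ hj₀
        · intro hy j hj
          split_ifs with hcj'
          · rwa [hc j j₀ hcj' hcj]
          · refine h0 j (Finset.mem_erase.2 ⟨?_, hj⟩)
            rintro rfl; exact hcj' hcj
      · intro j hj
        rw [if_neg fun h => (Finset.mem_erase.1 hj).1 (hc _ _ h hcj),
          Measure.dirac_apply' _ (ht j), Set.indicator_of_mem (h0 j hj), Pi.one_apply]
    · push Not at h0
      obtain ⟨j, hj, hjt⟩ := h0
      have hcj' : ¬ c j := fun h => (Finset.mem_erase.1 hj).1 (hc _ _ h hcj)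
      rw [Finset.prod_eq_zero hj, mul_zero]
      · convert measure_empty (μ := ν)
        ext y
        simp only [Set.mem_preimage, Set.mem_pi, Finset.mem_coe, Set.mem_empty_iff_false,
          iff_false]
        intro h
        exact hjt (by simpa [hcj'] using h j (Finset.mem_of_mem_erase hj))
      · rw [if_neg hcj', Measure.dirac_apply' _ (ht j), Set.indicator_of_notMem hjt]
  · push Not at h
    by_cases h0 : ∀ j ∈ s, (0 : M) ∈ t j
    · rw [Finset.prod_eq_one]
      · convert measure_univ (μ := ν)
        ext y
        simp only [Set.mem_preimage, Set.mem_pi, Finset.mem_coe, Set.mem_univ, iff_true]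
        intro j hj
        simpa [h j hj] using h0 j hj
      · intro j hj
        rw [if_neg (h j hj), Measure.dirac_apply' _ (ht j), Set.indicator_of_mem (h0 j hj),
          Pi.one_apply]
    · push Not at h0
      obtain ⟨j, hj, hjt⟩ := h0
      rw [Finset.prod_eq_zero hj]
      · convert measure_empty (μ := ν)
        ext y
        simp only [Set.mem_preimage, Set.mem_pi, Finset.mem_coe, Set.mem_empty_iff_false,
          iff_false]
        intro h'
        exact hjt (by simpa [h j hj] using h' j hj)
      · rw [if_neg (h j hj), Measure.dirac_apply' _ (ht j), Set.indicator_of_notMem hjt]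

/-- If the laws `μ a` form a convolution semigroup, then sums of independent variables `Y k`
with laws `μ (a k)`, sorted into disjoint blocks, are independent with laws `μ (∑ a k)`. -/
theorem hasLaw_block_sum {Ω ι J M S : Type*} [MeasurableSpace Ω] [Fintype J] [AddCommMonoid M]
    [MeasurableSpace M] [MeasurableAdd₂ M] [AddCommMonoid S] {Q : Measure Ω}
    [IsProbabilityMeasure Q] (p : S → Prop) (hp0 : p 0) (hpadd : ∀ a b, p a → p b → p (a + b))
    (μ : S → Measure M) (hμ : ∀ a, p a → IsProbabilityMeasure (μ a))
    (h0 : μ 0 = Measure.dirac 0) (hadd : ∀ a b, p a → p b → μ a ∗ μ b = μ (a + b))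
    (Y : ι → Ω → M) (a : ι → S) (ha : ∀ k, p (a k)) (hm : ∀ k, Measurable (Y k))
    (hY : ∀ k, HasLaw (Y k) (μ (a k)) Q)
    (hind : iIndepFun Y Q) (c : ι → J → Prop) [∀ k, DecidablePred (c k)]
    (hc : ∀ k i j, c k i → c k j → i = j) (F : Finset ι) :
    HasLaw (fun ω j => ∑ k ∈ F, if c k j then Y k ω else 0)
      (Measure.pi fun j => μ (∑ k ∈ F, if c k j then a k else 0)) Q := by
  classical
  have hps : ∀ (F : Finset ι) j, p (∑ k ∈ F, if c k j then a k else 0) := by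
    intro F j
    induction F using Finset.induction_on with
    | empty => simpa using hp0
    | insert k F hk ih =>
      rw [Finset.sum_insert hk]
      refine hpadd _ _ ?_ ih
      split_ifs
      exacts [ha k, hp0]
  induction F using Finset.induction_on with
  | empty =>
    simp only [Finset.sum_empty]
    refine ⟨aemeasurable_const, ?_⟩
    simp only [h0, Measure.map_const, measure_univ, one_smul]
    rw [← Measure.infinitePi_eq_pi, Measure.infinitePi_dirac]
  | insert k F hk ih =>
    have := hμ (a k) (ha k)
    have e1 : (fun ω j => ∑ i ∈ insert k F, if c i j then Y i ω else 0) =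
        (fun ω j => ∑ i ∈ F, if c i j then Y i ω else 0) +
        fun ω j => if c k j then Y k ω else 0 := by
      ext ω j
      rw [Finset.sum_insert hk, add_comm]; rfl
    -- `Y k` enters at most one block, so its vector of block contributions has at most one
    -- nonconstant coordinate and is a product law.
    have hone : HasLaw (fun ω j => if c k j then Y k ω else 0)
        (Measure.pi fun j => μ (if c k j then a k else 0)) Q := by
      have hmm : Measurable fun (y : M) (j : J) => if c k j then y else 0 :=
        measurable_pi_lambda _ fun j => by split_ifs <;> fun_prop
      have := map_ite_eq_infinitePi (μ (a k)) (c k) (hc k)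
      have hpr : ∀ j, IsProbabilityMeasure (if c k j then μ (a k) else Measure.dirac 0) :=
        fun j => by split_ifs <;> infer_instance
      have e2 : (fun j => μ (if c k j then a k else 0)) =
          fun j => if c k j then μ (a k) else Measure.dirac 0 := by
        ext1 j; split_ifs <;> simp [h0]
      rw [e2, ← Measure.infinitePi_eq_pi, ← this]
      have h3 := (hY k).map_eq
      refine ⟨(hmm.comp (hm k)).aemeasurable, ?_⟩
      rw [← h3, Measure.map_map hmm (hm k)]; rfl
    have hI : IndepFun (fun ω j => ∑ i ∈ F, if c i j then Y i ω else 0)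
        (fun ω j => if c k j then Y k ω else 0) Q := by
      have h := hind.indepFun_finset F {k} (by simpa using hk) hm
      refine h.comp (φ := fun (v : F → M) (j : J) => ∑ i : F, if c i j then v i else 0)
        (ψ := fun (v : ({k} : Finset ι) → M) (j : J) =>
          if c k j then v ⟨k, Finset.mem_singleton_self k⟩ else 0) ?_ ?_ |>.congr ?_ ?_
      · refine measurable_pi_lambda _ fun j => Finset.measurable_sum _ fun i _ => ?_
        split_ifs <;> fun_prop
      · refine measurable_pi_lambda _ fun j => ?_
        split_ifs <;> fun_prop
      · refine .of_forall fun ω => funext fun j => ?_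
        exact Finset.sum_coe_sort F (fun i => if c i j then Y i ω else 0)
      · exact .of_forall fun ω => rfl
    have := fun j => hμ _ (hps F j)
    have : ∀ j, IsProbabilityMeasure (μ (if c k j then a k else 0)) := fun j =>
      hμ _ (by split_ifs; exacts [ha k, hp0])
    have h5 := hI.hasLaw_add ih hone
    rw [pi_conv_pi] at h5
    rw [e1]
    convert h5 using 3 with j
    rw [Finset.sum_insert hk, add_comm, hadd _ _ (hps F j) (by split_ifs; exacts [ha k, hp0])]

/-! ### Gamma laws: additivity, scaling and Poisson conjugacy. -/

/-- The integral of a nonintegrable function is zero by convention, so divergence for `t ≥ r` fixes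
the value of the moment generating function there. It can then be compared as a function on all of
ℝ. -/
theorem not_integrable_exp_mul_gammaMeasure {a r t : ℝ} (ha : 0 < a) (hr : 0 < r) (ht : r ≤ t) :
    ¬ Integrable (fun x => Real.exp (t * x)) (gammaMeasure a r) := by
  intro h
  rw [gammaMeasure, integrable_withDensity_iff (by unfold gammaPDF; fun_prop)
    (.of_forall fun x => by exact ENNReal.ofReal_lt_top)] at h
  have hC : 0 < r ^ a / Real.Gamma a := div_pos (Real.rpow_pos_of_pos hr a) (Real.Gamma_pos_of_pos ha)
  -- For `t ≥ r` the integrand dominates a multiple of `x ^ (a - 1)`, and no power is integrable on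
  -- the whole half-line.
  refine not_integrableOn_Ioi_rpow (a - 1) ?_
  refine Integrable.mono' (g := fun x => (r ^ a / Real.Gamma a)⁻¹ *
    (Real.exp (t * x) * (gammaPDF a r x).toReal)) (h.const_mul _).integrableOn
    (by fun_prop) ?_
  filter_upwards [ae_restrict_mem measurableSet_Ioi] with x hx
  have hx : 0 < x := hx
  rw [gammaPDF_of_nonneg hx.le, ENNReal.toReal_ofReal (by positivity), Real.norm_of_nonneg (by positivity)]
  have : (r ^ a / Real.Gamma a)⁻¹ * (Real.exp (t * x) *
      (r ^ a / Real.Gamma a * x ^ (a - 1) * Real.exp (-(r * x)))) =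
      x ^ (a - 1) * Real.exp ((t - r) * x) := by
    rw [show (t - r) * x = t * x + -(r * x) by ring, Real.exp_add]
    field_simp
  rw [this]
  exact le_mul_of_one_le_right (by positivity)
    (Real.one_le_exp (mul_nonneg (sub_nonneg.2 ht) hx.le))

theorem integral_exp_mul_gammaMeasure {a r t : ℝ} (ha : 0 < a) (hr : 0 < r) (ht : t < r) :
    ∫ x, Real.exp (t * x) ∂gammaMeasure a r = (r / (r - t)) ^ a := by
  rw [gammaMeasure, integral_withDensity_eq_integral_toReal_smul
    (by unfold gammaPDF; fun_prop) (.of_forall fun x => by exact ENNReal.ofReal_lt_top)]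
  have hG := Real.Gamma_pos_of_pos ha
  have h1 : ∫ x, (gammaPDF a r x).toReal • Real.exp (t * x) =
      ∫ x in Set.Ioi 0, (r ^ a / Real.Gamma a) * (x ^ (a - 1) * Real.exp (-((r - t) * x))) := by
    rw [← integral_Ici_eq_integral_Ioi, ← integral_indicator measurableSet_Ici]
    congr 1
    ext x
    by_cases hx : 0 ≤ x
    · rw [Set.indicator_of_mem (Set.mem_Ici.2 hx), gammaPDF_of_nonneg hx,
        ENNReal.toReal_ofReal (by positivity), smul_eq_mul,
        show -((r - t) * x) = -(r * x) + t * x by ring, Real.exp_add]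
      ring
    · rw [Set.indicator_of_notMem (by simpa using hx), gammaPDF_of_neg (not_le.1 hx)]
      simp
  rw [h1, integral_const_mul, Real.integral_rpow_mul_exp_neg_mul_Ioi ha (sub_pos.2 ht),
    Real.div_rpow zero_le_one (sub_pos.2 ht).le, Real.div_rpow hr.le (sub_pos.2 ht).le,
    Real.one_rpow]
  field_simp

theorem mgf_gammaMeasure {a r : ℝ} (ha : 0 < a) (hr : 0 < r) (t : ℝ) :
    mgf id (gammaMeasure a r) t = if t < r then (r / (r - t)) ^ a else 0 := by
  split_ifs with ht
  · exact integral_exp_mul_gammaMeasure ha hr ht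
  · exact integral_undef (not_integrable_exp_mul_gammaMeasure ha hr (not_lt.1 ht))

/-- This places the imaginary axis in the open strip where equality of moment generating functions
extends analytically, and so yields equality of characteristic functions. -/
theorem mem_interior_integrableExpSet_gammaMeasure {a r : ℝ} (ha : 0 < a) (hr : 0 < r) :
    0 ∈ interior (integrableExpSet id (gammaMeasure a r)) := by
  have := isProbabilityMeasure_gammaMeasure ha hr
  refine mem_interior.2 ⟨Set.Iio r, fun t ht => ?_, isOpen_Iio, hr⟩
  have ht : t < r := ht
  refine Integrable.of_integral_ne_zero ?_
  have h := integral_exp_mul_gammaMeasure ha hr ht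
  simp only [id]
  rw [h]
  exact (Real.rpow_pos_of_pos (div_pos hr (sub_pos.2 ht)) a).ne'

/-- A probability measure with the moment generating function of a gamma law is that law. -/
theorem eq_gammaMeasure_of_mgf {a r : ℝ} (ha : 0 < a) (hr : 0 < r) (μ : Measure ℝ)
    [IsProbabilityMeasure μ] (h : mgf id μ = mgf id (gammaMeasure a r)) :
    μ = gammaMeasure a r := by
  have := isProbabilityMeasure_gammaMeasure ha hr
  refine (Measure.ext_of_charFun ?_).symm
  ext t
  have h1 := eqOn_complexMGF_of_mgf h.symm (x := t * Complex.I) (by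
    simpa using mem_interior_integrableExpSet_gammaMeasure ha hr)
  rw [complexMGF_mul_I aemeasurable_id, complexMGF_mul_I aemeasurable_id] at h1
  simpa using h1

theorem gammaMeasure_conv {a b r : ℝ} (ha : 0 < a) (hb : 0 < b) (hr : 0 < r) :
    gammaMeasure a r ∗ gammaMeasure b r = gammaMeasure (a + b) r := by
  have := isProbabilityMeasure_gammaMeasure ha hr
  have := isProbabilityMeasure_gammaMeasure hb hr
  refine eq_gammaMeasure_of_mgf (add_pos ha hb) hr _ ?_
  ext t
  have h1 : mgf id (gammaMeasure a r ∗ gammaMeasure b r) t =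
      mgf id (gammaMeasure a r) t * mgf id (gammaMeasure b r) t := by
    unfold mgf
    rw [Measure.conv, integral_map (by fun_prop) (by fun_prop), ← integral_prod_mul]
    simp [mul_add, Real.exp_add]
  rw [h1, mgf_gammaMeasure ha hr, mgf_gammaMeasure hb hr, mgf_gammaMeasure (add_pos ha hb) hr]
  split_ifs with ht
  · rw [Real.rpow_add (div_pos hr (sub_pos.2 ht))]
  · simp

theorem gammaMeasure_map_const_mul {a r c : ℝ} (ha : 0 < a) (hr : 0 < r) (hc : 0 < c) :
    (gammaMeasure a r).map (c * ·) = gammaMeasure a (r / c) := by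
  have := isProbabilityMeasure_gammaMeasure ha hr
  have : IsProbabilityMeasure ((gammaMeasure a r).map (c * ·)) :=
    Measure.isProbabilityMeasure_map (by fun_prop)
  refine eq_gammaMeasure_of_mgf ha (div_pos hr hc) _ ?_
  ext t
  have h1 : mgf id ((gammaMeasure a r).map (c * ·)) t = mgf id (gammaMeasure a r) (c * t) := by
    unfold mgf
    rw [integral_map (by fun_prop) (by fun_prop)]
    simp only [id]
    congr 1
    ext x
    ring_nf
  rw [h1, mgf_gammaMeasure ha hr, mgf_gammaMeasure ha (div_pos hr hc)]
  have e : t < r / c ↔ c * t < r := by rw [lt_div_iff₀ hc, mul_comm]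
  simp only [e]
  split_ifs with ht
  · have h2 : r - c * t ≠ 0 := (sub_pos.2 ht).ne'
    congr 1
    rw [show r / c - t = (r - c * t) / c by field_simp]
    field_simp
  · rfl

theorem gammaMeasure_Iic_zero (a r : ℝ) : gammaMeasure a r (Set.Iic 0) = 0 := by
  rw [gammaMeasure, withDensity_apply _ measurableSet_Iic, ← setLIntegral_congr Iio_ae_eq_Iic]
  exact lintegral_gammaPDF_of_nonpos le_rfl

theorem map_coe_gammaLaw {a r : ℝ} (ha : 0 < a) :
    (gammaLaw a r).map ((↑) : ℝ≥0 → ℝ) = gammaMeasure a r := by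
  rw [gammaLaw, if_neg ha.ne', Measure.map_map (by fun_prop) (by fun_prop)]
  conv_rhs => rw [← Measure.map_id (μ := gammaMeasure a r)]
  refine Measure.map_congr ?_
  have : ∀ᵐ x ∂gammaMeasure a r, x ∉ Set.Iic 0 :=
    measure_eq_zero_iff_ae_notMem.1 (gammaMeasure_Iic_zero a r)
  filter_upwards [this] with x hx
  simp at hx
  simp [hx.le]

theorem gammaLaw_zero (r : ℝ) : gammaLaw 0 r = Measure.dirac 0 := by simp [gammaLaw]

theorem isProbabilityMeasure_gammaLaw {a r : ℝ} (ha : 0 ≤ a) (hr : 0 < r) :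
    IsProbabilityMeasure (gammaLaw a r) := by
  unfold gammaLaw
  split_ifs with h
  · infer_instance
  · have := isProbabilityMeasure_gammaMeasure (lt_of_le_of_ne ha (Ne.symm h)) hr
    exact Measure.isProbabilityMeasure_map (by fun_prop)

theorem measurableEmbedding_coe_nnreal : MeasurableEmbedding ((↑) : ℝ≥0 → ℝ) :=
  MeasurableEmbedding.subtype_coe measurableSet_Ici

theorem measure_ext_of_map_coe {μ ν : Measure ℝ≥0}
    (h : μ.map ((↑) : ℝ≥0 → ℝ) = ν.map ((↑) : ℝ≥0 → ℝ)) : μ = ν := by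
  rw [← measurableEmbedding_coe_nnreal.comap_map μ, h, measurableEmbedding_coe_nnreal.comap_map]

theorem gammaLaw_conv {a b r : ℝ} (ha : 0 ≤ a) (hb : 0 ≤ b) (hr : 0 < r) :
    gammaLaw a r ∗ gammaLaw b r = gammaLaw (a + b) r := by
  have := isProbabilityMeasure_gammaLaw ha hr
  have := isProbabilityMeasure_gammaLaw hb hr
  rcases ha.eq_or_lt with rfl | ha'
  · rw [gammaLaw_zero, Measure.dirac_zero_conv, zero_add]
  rcases hb.eq_or_lt with rfl | hb'
  · rw [gammaLaw_zero, Measure.conv_dirac_zero, add_zero]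
  refine measure_ext_of_map_coe ?_
  have h := Measure.map_conv_addMonoidHom (μ := gammaLaw a r) (ν := gammaLaw b r)
    NNReal.toRealHom.toAddMonoidHom (by exact measurable_coe_nnreal_real)
  change Measure.map ((↑) : ℝ≥0 → ℝ) _ = Measure.map ((↑) : ℝ≥0 → ℝ) _ ∗
    Measure.map ((↑) : ℝ≥0 → ℝ) _ at h
  rw [h, map_coe_gammaLaw ha', map_coe_gammaLaw hb', map_coe_gammaLaw (add_pos ha' hb'),
    gammaMeasure_conv ha' hb' hr]

theorem gammaLaw_map_const_mul {a r : ℝ} {c : ℝ≥0} (ha : 0 ≤ a) (hr : 0 < r) (hc : 0 < c) :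
    (gammaLaw a r).map (c * ·) = gammaLaw a (r / c) := by
  rcases ha.eq_or_lt with rfl | ha'
  · rw [gammaLaw_zero, gammaLaw_zero, Measure.map_dirac' (by fun_prop), mul_zero]
  refine measure_ext_of_map_coe ?_
  rw [map_coe_gammaLaw ha', ← gammaMeasure_map_const_mul ha' hr (NNReal.coe_pos.2 hc),
    ← map_coe_gammaLaw ha', Measure.map_map (by fun_prop) (by fun_prop),
    Measure.map_map (by fun_prop) (by fun_prop)]
  congr 1

theorem gammaLaw_singleton_zero {a r : ℝ} (ha : 0 < a) : gammaLaw a r {0} = 0 := by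
  rw [gammaLaw, if_neg ha.ne', Measure.map_apply (by fun_prop) (measurableSet_singleton 0)]
  refine measure_mono_null (fun x hx => ?_) (gammaMeasure_Iic_zero a r)
  simpa using hx

/-- Gamma–Poisson conjugacy. -/
theorem gammaLaw_withDensity_poisson {a r φ : ℝ} (ha : 0 ≤ a) (hr : 0 < r) (hφ : 0 < φ) (n : ℕ) :
    ∃ C : ℝ≥0∞, (gammaLaw a r).withDensity (fun g => poissonMeasure (φ.toNNReal * g) {n}) =
      C • gammaLaw (a + n) (r + φ) := by
  have hmeas : Measurable fun g : ℝ≥0 => poissonMeasure (φ.toNNReal * g) {n} := by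
    simp only [poissonMeasure_singleton]; fun_prop
  rcases ha.eq_or_lt with rfl | ha'
  · have hd : (Measure.dirac (0 : ℝ≥0)).withDensity
        (fun g => poissonMeasure (φ.toNNReal * g) {n}) =
        poissonMeasure (φ.toNNReal * 0) {n} • Measure.dirac 0 := by
      ext s hs
      classical
      rw [withDensity_apply _ hs, setLIntegral_dirac' hmeas hs, Measure.smul_apply,
        Measure.dirac_apply' _ hs]
      by_cases h : (0 : ℝ≥0) ∈ s <;> simp [h]
    rw [gammaLaw_zero, hd, mul_zero]
    -- The prior is the point mass at zero: a zero count leaves it unchanged, and a positive count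
    -- has likelihood zero, so `C = 0` serves.
    rcases Nat.eq_zero_or_pos n with rfl | hn
    · exact ⟨poissonMeasure 0 {0}, by simp [gammaLaw_zero]⟩
    · refine ⟨0, ?_⟩
      simp [poissonMeasure_singleton, hn.ne']
  have hm : 0 < a + n := by positivity
  have hG := Real.Gamma_pos_of_pos ha'
  have hG' := Real.Gamma_pos_of_pos hm
  -- Prior normalizing constant times the `φ ^ n / n!` of the likelihood, divided by the posterior
  -- normalizing constant.
  refine ⟨ENNReal.ofReal ((r ^ a / Real.Gamma a) * (φ ^ n / n.factorial) /
    ((r + φ) ^ (a + n) / Real.Gamma (a + n))), ?_⟩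
  rw [gammaLaw, if_neg ha'.ne', gammaLaw, if_neg hm.ne']
  ext s hs
  have hmt : Measurable Real.toNNReal := by fun_prop
  rw [withDensity_apply _ hs, setLIntegral_map hs hmeas hmt, Measure.smul_apply,
    Measure.map_apply hmt hs, gammaMeasure, gammaMeasure, withDensity_apply _ (hmt hs),
    setLIntegral_withDensity_eq_setLIntegral_mul _ (by unfold gammaPDF; fun_prop)
      (by exact hmeas.comp hmt) (hmt hs), smul_eq_mul,
    ← lintegral_const_mul _ (by unfold gammaPDF; fun_prop)]
  -- The origin is discarded because splitting `x ^ (a - 1 + n)` into a product of powers uses `x >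
  -- 0`.
  have hne : ∀ᵐ x : ℝ, x ≠ 0 := by simp [ae_iff]
  refine lintegral_congr_ae (ae_restrict_of_ae ?_)
  filter_upwards [hne] with x hx0
  rcases lt_or_gt_of_ne hx0 with hx | hx
  · simp [gammaPDF_of_neg hx]
  · simp only [Pi.mul_apply]
    rw [gammaPDF_of_nonneg hx.le, gammaPDF_of_nonneg hx.le, poissonMeasure_singleton,
      ← ENNReal.ofReal_mul (by positivity), ← ENNReal.ofReal_mul (by positivity)]
    congr 1
    rw [NNReal.coe_mul, Real.coe_toNNReal _ hφ.le, Real.coe_toNNReal _ hx.le,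
      show a + n - 1 = (a - 1) + n by ring, Real.rpow_add hx, Real.rpow_natCast,
      show -((r + φ) * x) = -(r * x) + -(φ * x) by ring, Real.exp_add]
    have : 0 < (r + φ) ^ (a + n) := by positivity
    field_simp
    ring

/-- The law `Gamma(a, r)` as a measure on `[0, ∞]`. -/
noncomputable def gammaLawENNReal (a r : ℝ) : Measure ℝ≥0∞ :=
  (gammaLaw a r).map ((↑) : ℝ≥0 → ℝ≥0∞)

theorem gammaLawENNReal_zero (r : ℝ) : gammaLawENNReal 0 r = Measure.dirac 0 := by
  rw [gammaLawENNReal, gammaLaw_zero, Measure.map_dirac' (by fun_prop), ENNReal.coe_zero]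

theorem isProbabilityMeasure_gammaLawENNReal {a r : ℝ} (ha : 0 ≤ a) (hr : 0 < r) :
    IsProbabilityMeasure (gammaLawENNReal a r) := by
  have := isProbabilityMeasure_gammaLaw ha hr
  exact Measure.isProbabilityMeasure_map (by fun_prop)

theorem gammaLawENNReal_conv {a b r : ℝ} (ha : 0 ≤ a) (hb : 0 ≤ b) (hr : 0 < r) :
    gammaLawENNReal a r ∗ gammaLawENNReal b r = gammaLawENNReal (a + b) r := by
  have := isProbabilityMeasure_gammaLaw ha hr
  have := isProbabilityMeasure_gammaLaw hb hr
  have h := Measure.map_conv_addMonoidHom (μ := gammaLaw a r) (ν := gammaLaw b r)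
    ENNReal.ofNNRealHom.toAddMonoidHom (by exact measurable_coe_nnreal_ennreal)
  rw [gammaLaw_conv ha hb hr] at h
  exact h.symm

theorem gammaLawENNReal_map_const_mul {a r : ℝ} {c : ℝ≥0} (ha : 0 ≤ a) (hr : 0 < r) (hc : 0 < c) :
    (gammaLawENNReal a r).map ((c : ℝ≥0∞) * ·) = gammaLawENNReal a (r / c) := by
  rw [gammaLawENNReal, gammaLawENNReal, ← gammaLaw_map_const_mul ha hr hc,
    Measure.map_map (by fun_prop) (by fun_prop), Measure.map_map (by fun_prop) (by fun_prop)]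
  congr 1

theorem gammaLawENNReal_singleton_zero {a r : ℝ} (ha : 0 < a) : gammaLawENNReal a r {0} = 0 := by
  rw [gammaLawENNReal, Measure.map_apply (by fun_prop) (measurableSet_singleton 0)]
  refine measure_mono_null (fun x hx => ?_) (gammaLaw_singleton_zero (r := r) ha)
  simpa using hx

theorem gammaLawENNReal_singleton_top (a r : ℝ) : gammaLawENNReal a r {∞} = 0 := by
  rw [gammaLawENNReal, Measure.map_apply (by fun_prop) (measurableSet_singleton _)]
  convert measure_empty (μ := gammaLaw a r)
  ext x
  simp

theorem gammaLawENNReal_withDensity_poisson {a r φ : ℝ} (ha : 0 ≤ a) (hr : 0 < r) (hφ : 0 < φ)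
    (n : ℕ) :
    ∃ C : ℝ≥0∞, (gammaLawENNReal a r).withDensity
      (fun g => poissonMeasure (φ.toNNReal * g.toNNReal) {n}) =
      C • gammaLawENNReal (a + n) (r + φ) := by
  obtain ⟨C, hC⟩ := gammaLaw_withDensity_poisson ha hr hφ n
  refine ⟨C, ?_⟩
  rw [gammaLawENNReal, gammaLawENNReal, ← Measure.map_smul, ← hC]
  have hc : Measurable ((↑) : ℝ≥0 → ℝ≥0∞) := by fun_prop
  ext s hs
  rw [withDensity_apply _ hs, Measure.map_apply hc hs, withDensity_apply _ (hc hs),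
    setLIntegral_map hs (by simp only [poissonMeasure_singleton]; fun_prop) hc]
  simp

/-! ### Poisson counts summed over disjoint blocks. -/

/-- Partial sums are monotone and integer-valued, so they can reach a finite limit only by becoming
constant. This gives pointwise convergence of indicators when finite block sums are replaced by
infinite ones. -/
theorem eventually_sum_range_eq_iff (f : ℕ → ℕ) (n : ℕ) :
    ∀ᶠ N in Filter.atTop, (∑ k ∈ Finset.range N, f k = n ↔ ∑' k, (f k : ℝ≥0∞) = n) := by
  have ht : Filter.Tendsto (fun N => ((∑ k ∈ Finset.range N, f k : ℕ) : ℝ≥0∞)) Filter.atTop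
      (nhds (∑' k, (f k : ℝ≥0∞))) := by
    simpa using (ENNReal.summable (f := fun k => (f k : ℝ≥0∞))).hasSum.tendsto_sum_nat
  have hmono : Monotone fun N => ∑ k ∈ Finset.range N, f k := fun a b hab =>
    Finset.sum_le_sum_of_subset (Finset.range_mono hab)
  have hle : ∀ N, ((∑ k ∈ Finset.range N, f k : ℕ) : ℝ≥0∞) ≤ ∑' k, (f k : ℝ≥0∞) := fun N => by
    simpa using ENNReal.sum_le_tsum (f := fun k => (f k : ℝ≥0∞)) (Finset.range N)
  by_cases h : ∑' k, (f k : ℝ≥0∞) = n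
  · rw [h] at hle ht
    have : ∃ N₀, ∑ k ∈ Finset.range N₀, f k = n := by
      by_contra! hne
      have hlt : ∀ N, ((∑ k ∈ Finset.range N, f k : ℕ) : ℝ≥0∞) ≤ ((n - 1 : ℕ) : ℝ≥0∞) := fun N => by
        have h1 : ∑ k ∈ Finset.range N, f k ≤ n := by exact_mod_cast hle N
        have h2 := hne N
        exact_mod_cast (by omega)
      have h3 : n ≤ n - 1 := by exact_mod_cast le_of_tendsto' ht hlt
      -- Truncated subtraction leaves `n = 0` possible, and the empty partial sum rules it out.
      have h4 := hne 0
      simp at h4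
      omega
    obtain ⟨N₀, hN₀⟩ := this
    filter_upwards [Filter.eventually_ge_atTop N₀] with N hN
    refine iff_of_true (le_antisymm (by exact_mod_cast hle N) ?_) h
    rw [← hN₀]
    exact hmono hN
  · filter_upwards [ht.eventually_ne h] with N hN
    exact iff_of_false (fun h' => hN (by rw [h'])) h

theorem tendsto_poissonMeasure_singleton {r : ℕ → ℝ≥0} {r₀ : ℝ≥0}
    (h : Filter.Tendsto r Filter.atTop (nhds r₀)) (n : ℕ) :
    Filter.Tendsto (fun N => poissonMeasure (r N) {n}) Filter.atTop
      (nhds (poissonMeasure r₀ {n})) := by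
  simp only [poissonMeasure_singleton]
  refine ENNReal.tendsto_ofReal ?_
  have hc : Continuous fun s : ℝ≥0 => Real.exp (-s) * (s : ℝ) ^ n / n.factorial := by fun_prop
  exact (hc.tendsto r₀).comp h

/-- Sums of independent Poisson variables over disjoint blocks are independent Poisson. -/
theorem infinitePi_poisson_block {J : Type*} [Fintype J] (r : ℕ → ℝ≥0) (c : ℕ → J → Prop)
    [∀ k, DecidablePred (c k)] (hc : ∀ k i j, c k i → c k j → i = j)
    (hfin : ∀ j, ∑' k, (if c k j then (r k : ℝ≥0∞) else 0) ≠ ∞) (n : J → ℕ) :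
    Measure.infinitePi (fun k => poissonMeasure (r k))
      {u | ∀ j, ∑' k, (if c k j then (u k : ℝ≥0∞) else 0) = n j} =
      ∏ j, poissonMeasure (∑' k, if c k j then (r k : ℝ≥0∞) else 0).toNNReal {n j} := by
  set ν := Measure.infinitePi fun k => poissonMeasure (r k)
  have hblock := hasLaw_block_sum (Q := ν) (fun _ : ℝ≥0 => True) trivial (fun _ _ _ _ => trivial)
    poissonMeasure (fun a _ => inferInstance) (by
      refine Measure.ext_of_singleton fun m => ?_
      rw [poissonMeasure_singleton]
      rcases Nat.eq_zero_or_pos m with rfl | hm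
      · simp
      · simp [hm.ne', hm.ne]) (fun a b _ _ => poissonMeasure_conv_poissonMeasure a b)
    (fun k (u : ℕ → ℕ) => u k) r (fun _ => trivial) (fun k => by fun_prop)
    (fun k => (measurePreserving_eval_infinitePi (fun k => poissonMeasure (r k)) k).hasLaw)
    (iIndepFun_infinitePi (X := fun k => id) fun k => measurable_id) c hc
  have hN : ∀ N, ν {u | ∀ j, ∑ k ∈ Finset.range N, (if c k j then u k else 0) = n j} =
      ∏ j, poissonMeasure (∑ k ∈ Finset.range N, if c k j then r k else 0) {n j} := by
    intro N
    rw [← Measure.pi_singleton, ← (hblock (Finset.range N)).map_eq,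
      Measure.map_apply_of_aemeasurable (hblock (Finset.range N)).aemeasurable
        (measurableSet_singleton _)]
    congr 1
    ext u
    simp [funext_iff]
  have hl1 : Filter.Tendsto
      (fun N => ν {u | ∀ j, ∑ k ∈ Finset.range N, (if c k j then u k else 0) = n j})
      Filter.atTop (nhds (ν {u | ∀ j, ∑' k, (if c k j then (u k : ℝ≥0∞) else 0) = n j})) := by
    refine tendsto_measure_of_tendsto_indicator_of_isFiniteMeasure Filter.atTop ν
      (fun N => ?_) fun u => ?_
    · have hmeas : Measurable fun (u : ℕ → ℕ) (j : J) =>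
          ∑ k ∈ Finset.range N, (if c k j then u k else 0) :=
        measurable_pi_lambda _ fun j => Finset.measurable_sum _ fun k _ => by
          split_ifs <;> fun_prop
      convert hmeas (measurableSet_singleton n) using 1
      ext u
      simp [funext_iff]
    · have := Filter.eventually_all.2 fun j =>
        eventually_sum_range_eq_iff (fun k => if c k j then u k else 0) (n j)
      filter_upwards [this] with N h
      refine forall_congr' fun j => ?_
      rw [h j]
      simp only [Nat.cast_ite, Nat.cast_zero]
  refine tendsto_nhds_unique hl1 ?_
  simp only [hN]
  refine ENNReal.tendsto_finsetProd_of_ne_top _ (fun j _ => tendsto_poissonMeasure_singleton ?_ _)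
    fun j _ => measure_ne_top _ _
  have h1 := (ENNReal.summable (f := fun k => if c k j then (r k : ℝ≥0∞) else 0)).hasSum.tendsto_sum_nat
  refine (ENNReal.tendsto_toNNReal (hfin j)).comp h1 |>.congr fun N => ?_
  have : ∑ k ∈ Finset.range N, (if c k j then (r k : ℝ≥0∞) else 0) =
      ((∑ k ∈ Finset.range N, if c k j then r k else 0 : ℝ≥0) : ℝ≥0∞) := by
    push_cast
    exact Finset.sum_congr rfl fun k _ => by split_ifs <;> simp
  rw [Function.comp, this, ENNReal.toNNReal_coe]

/-! ### The conditional Poisson model as a Markov kernel. -/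

/-- A family of product measures whose factors depend measurably on a parameter is a kernel. -/
theorem measurable_infinitePi {Z ι : Type*} [MeasurableSpace Z] {E : ι → Type*}
    [∀ i, MeasurableSpace (E i)] (μ : Z → ∀ i, Measure (E i))
    [∀ z i, IsProbabilityMeasure (μ z i)] (hμ : ∀ i, Measurable fun z => μ z i) :
    Measurable fun z => Measure.infinitePi (μ z) := by
  refine Measurable.measure_of_isPiSystem_of_isProbabilityMeasure
    (generateFrom_squareCylinders (α := E)).symm
    (isPiSystem_squareCylinders (fun i => MeasurableSpace.isPiSystem_measurableSet)
      fun i => .univ) ?_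
  rintro _ ⟨s, t, ht, rfl⟩
  have h (z : Z) : Measure.infinitePi (μ z) (Set.pi s t) = ∏ i ∈ s, μ z i (t i) :=
    Measure.infinitePi_pi _ fun i _ => ht i trivial
  simp only [h]
  exact Finset.measurable_prod _ fun i _ => (Measure.measurable_coe (ht i trivial)).comp (hμ i)

/-- Given masses and locations, independent Poisson counts with means `φ wₖ`. -/
noncomputable def poissonCountKernel (𝓧 : Type v) [MeasurableSpace 𝓧] (φ : ℝ) :
    Kernel (ℕ → ℝ≥0 × 𝓧) (ℕ → ℕ) where
  toFun z := Measure.infinitePi fun k => poissonMeasure (φ.toNNReal * (z k).1)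
  measurable' := measurable_infinitePi _ fun k => by
    refine Measure.measurable_of_measurable_coe _ fun s hs => ?_
    have h (z : ℕ → ℝ≥0 × 𝓧) : poissonMeasure (φ.toNNReal * (z k).1) s =
        ∑' n : s, poissonMeasure (φ.toNNReal * (z k).1) {(n : ℕ)} := by
      rw [← measure_biUnion s.to_countable (fun i _ j _ h => by simpa using h)
        fun i _ => measurableSet_singleton i, Set.biUnion_of_singleton]
    simp only [h, poissonMeasure_singleton]
    fun_prop

instance (𝓧 : Type v) [MeasurableSpace 𝓧] (φ : ℝ) : IsMarkovKernel (poissonCountKernel 𝓧 φ) :=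
  ⟨fun z => by change IsProbabilityMeasure (Measure.infinitePi _); infer_instance⟩

/-- Two finite measures on sequences of naturals agree if they agree on cylinders. -/
theorem measure_nat_seq_ext {μ ν : Measure (ℕ → ℕ)} [IsFiniteMeasure μ]
    (h : ∀ (s : Finset ℕ) (m : ℕ → ℕ), μ {u | ∀ k ∈ s, u k = m k} = ν {u | ∀ k ∈ s, u k = m k}) :
    μ = ν := by
  have : IsFiniteMeasure ν := ⟨by
    have := h ∅ 0
    simp only [Finset.notMem_empty, false_imp_iff, implies_true, Set.ofPred_true] at this
    rw [← this]; exact measure_lt_top _ _⟩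
  refine IsProjectiveLimit.unique (P := fun I : Finset ℕ => μ.map I.restrict) (fun I => rfl)
    fun I => ?_
  refine Measure.ext_of_singleton fun (m : I → ℕ) => ?_
  rw [Measure.map_apply (Finset.measurable_restrict I) (measurableSet_singleton m),
    Measure.map_apply (Finset.measurable_restrict I) (measurableSet_singleton m)]
  have : (I.restrict : (ℕ → ℕ) → (I → ℕ)) ⁻¹' {m} =
      {u : ℕ → ℕ | ∀ k ∈ I, u k = (fun k => if hk : k ∈ I then m ⟨k, hk⟩ else 0) k} := by
    ext u
    simp only [Set.mem_preimage, Set.mem_singleton_iff, funext_iff, Subtype.forall, Finset.restrict,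
      Set.mem_ofPred_eq]
    exact forall_congr' fun k => forall_congr' fun hk => by rw [dif_pos hk]
  rw [this, h]

/-- The hypothesis controls only cylinder events, one null set at a time. Fixing the event `S` for
masses and locations turns both sides into finite measures of the count sequence, and these are
determined by cylinders; the defining property of conditional expectation, integrated over `S`,
matches them. -/
theorem IsCondPoisson.map_eq_compProd {Ω : Type u} [MeasurableSpace Ω] {P : Measure Ω}
    [IsProbabilityMeasure P] {𝓧 : Type v} [MeasurableSpace 𝓧] {φ : ℝ}
    {w : ℕ → Ω → ℝ≥0} {X : ℕ → Ω → 𝓧} {u : ℕ → Ω → ℕ}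
    (hw : ∀ k, Measurable (w k)) (hX : ∀ k, Measurable (X k)) (hu : IsCondPoisson u w X φ P) :
    P.map (fun ω => ((fun k => (w k ω, X k ω)), fun k => u k ω)) =
      (P.map fun ω k => (w k ω, X k ω)) ⊗ₘ poissonCountKernel 𝓧 φ := by
  obtain ⟨hum, hu⟩ := hu
  have hZ : Measurable fun ω k => (w k ω, X k ω) :=
    measurable_pi_lambda _ fun k => (hw k).prodMk (hX k)
  have hU : Measurable fun ω k => u k ω := measurable_pi_lambda _ hum
  have : IsProbabilityMeasure (P.map fun ω k => (w k ω, X k ω)) :=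
    Measure.isProbabilityMeasure_map hZ.aemeasurable
  have : IsProbabilityMeasure (P.map (fun ω => ((fun k => (w k ω, X k ω)), fun k => u k ω))) :=
    Measure.isProbabilityMeasure_map (hZ.prodMk hU).aemeasurable
  refine Measure.ext_prod fun {S T} hS hT => ?_
  have hS' := hZ hS
  have key : (P.restrict ((fun ω k => (w k ω, X k ω)) ⁻¹' S)).map (fun ω k => u k ω) =
      (poissonCountKernel 𝓧 φ) ∘ₘ ((P.map fun ω k => (w k ω, X k ω)).restrict S) := by
    refine measure_nat_seq_ext fun s m => ?_
    have hcm : MeasurableSet {v : ℕ → ℕ | ∀ k ∈ s, v k = m k} := by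
      have : {v : ℕ → ℕ | ∀ k ∈ s, v k = m k} = Set.pi s fun k => {m k} := by ext; simp
      rw [this]
      exact .pi s.countable_toSet fun k _ => measurableSet_singleton _
    have hce : MeasurableSet {ω | ∀ k ∈ s, u k ω = m k} := hU hcm
    have hpk (z : ℕ → ℝ≥0 × 𝓧) : poissonCountKernel 𝓧 φ z {v | ∀ k ∈ s, v k = m k} =
        ∏ k ∈ s, poissonMeasure (φ.toNNReal * (z k).1) {m k} := by
      have : {v : ℕ → ℕ | ∀ k ∈ s, v k = m k} = Set.pi s fun k => {m k} := by ext; simp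
      rw [this]
      exact Measure.infinitePi_pi _ fun k _ => measurableSet_singleton _
    rw [Measure.map_apply hU hcm, Measure.bind_apply hcm (Kernel.aemeasurable _),
      Measure.restrict_apply (hU hcm), ← lintegral_indicator hS,
      lintegral_map ((Kernel.measurable_coe _ hcm).indicator hS) hZ]
    have hm : MeasurableSpace.comap (fun ω k => (w k ω, X k ω)) inferInstance ≤
      (inferInstance : MeasurableSpace Ω) := hZ.comap_le
    have h1 := setIntegral_condExp hm (μ := P)
      (f := {ω | ∀ k ∈ s, u k ω = m k}.indicator fun _ => (1 : ℝ))
      ((integrable_const 1).indicator hce) (s := (fun ω k => (w k ω, X k ω)) ⁻¹' S) ⟨S, hS, rfl⟩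
    rw [setIntegral_congr_ae hS' ((hu s m).mono fun ω h _ => h), integral_indicator hce,
      setIntegral_const, smul_eq_mul, mul_one, Measure.real, Measure.restrict_apply hce] at h1
    have h2 : P ((fun ω k => u k ω) ⁻¹' {v | ∀ k ∈ s, v k = m k} ∩
        (fun ω k => (w k ω, X k ω)) ⁻¹' S) =
        ENNReal.ofReal (∫ ω in (fun ω k => (w k ω, X k ω)) ⁻¹' S,
          ∏ k ∈ s, (poissonMeasure (φ.toNNReal * w k ω)).real {m k} ∂P) := by
      rw [h1, ENNReal.ofReal_toReal (measure_ne_top _ _)]; rfl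
    have hmeas : Measurable fun ω =>
        ∏ k ∈ s, (poissonMeasure (φ.toNNReal * w k ω)).real {m k} := by
      simp only [poissonMeasure_real_singleton]
      fun_prop
    rw [h2, ofReal_integral_eq_lintegral_ofReal, ← lintegral_indicator hS']
    · congr 1
      ext ω
      by_cases h : (fun k => (w k ω, X k ω)) ∈ S
      · rw [Set.indicator_of_mem (by exact h), Set.indicator_of_mem h, hpk,
          ENNReal.ofReal_prod_of_nonneg fun k _ => measureReal_nonneg]
        simp
      · rw [Set.indicator_of_notMem (by exact h), Set.indicator_of_notMem h]
    · refine Integrable.of_bound hmeas.aestronglyMeasurable 1 (.of_forall fun ω => ?_)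
      rw [Real.norm_of_nonneg (Finset.prod_nonneg fun k _ => measureReal_nonneg)]
      exact Finset.prod_le_one (fun k _ => measureReal_nonneg) fun k _ => measureReal_le_one
    · exact .of_forall fun ω => Finset.prod_nonneg fun k _ => measureReal_nonneg
  have h3 := congrArg (fun μ => μ T) key
  rw [Measure.map_apply hU hT, Measure.restrict_apply (hU hT),
    Measure.bind_apply hT (Kernel.aemeasurable _)] at h3
  rw [Measure.map_apply (hZ.prodMk hU) (hS.prod hT), Measure.compProd_apply_prod hS hT, ← h3]
  congr 1
  ext ω
  simp [and_comm]

/-! ### Atomic measures and the finite-dimensional posterior. -/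

open Classical in
theorem atomicMeasure_apply {𝓧 : Type v} [MeasurableSpace 𝓧] (w : ℕ → ℝ≥0) (x : ℕ → 𝓧)
    {A : Set 𝓧} (hA : MeasurableSet A) :
    atomicMeasure w x A = ∑' k, if x k ∈ A then (w k : ℝ≥0∞) else 0 := by
  rw [atomicMeasure, Measure.sum_apply _ hA]
  refine tsum_congr fun k => ?_
  rw [Measure.smul_apply, Measure.dirac_apply' _ hA]
  by_cases h : x k ∈ A <;> simp [h]

theorem measurable_atomicMeasure {Z : Type*} [MeasurableSpace Z] {𝓧 : Type v} [MeasurableSpace 𝓧]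
    {w : ℕ → Z → ℝ≥0} {x : ℕ → Z → 𝓧} (hw : ∀ k, Measurable (w k)) (hx : ∀ k, Measurable (x k)) :
    Measurable fun z => atomicMeasure (w · z) (x · z) := by
  classical
  refine Measure.measurable_of_measurable_coe _ fun A hA => ?_
  simp only [atomicMeasure_apply _ _ hA]
  exact Measurable.tsum fun k =>
    Measurable.ite (hx k hA) (measurable_coe_nnreal_ennreal.comp (hw k)) measurable_const

/-- Tensorizes conjugacy: the likelihood of independent counts is a product, so its integral over a
box factors through independence of the coordinates. -/
theorem pi_withDensity_of_eq_smul {J E : Type*} [Fintype J] [MeasurableSpace E]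
    (μ ν : J → Measure E) [∀ j, IsProbabilityMeasure (μ j)] [∀ j, IsProbabilityMeasure (ν j)]
    (f : J → E → ℝ≥0∞) (hf : ∀ j, Measurable (f j)) (C : J → ℝ≥0)
    (h : ∀ j, (μ j).withDensity (f j) = (C j : ℝ≥0∞) • ν j) :
    (Measure.pi μ).withDensity (fun g => ∏ j, f j (g j)) =
      (∏ j, (C j : ℝ≥0∞)) • Measure.pi ν := by
  have h1 : Measure.pi (fun j => C j • ν j) =
      (Measure.pi μ).withDensity (fun g => ∏ j, f j (g j)) := by
    refine Measure.pi_eq fun s hs => ?_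
    rw [withDensity_apply _ (.univ_pi hs), ← lintegral_indicator (.univ_pi hs)]
    have e : ((Set.univ.pi s).indicator fun g : J → E => ∏ j, f j (g j)) =
        fun g => ∏ j, (s j).indicator (f j) (g j) := by
      ext g
      by_cases hg : g ∈ Set.univ.pi s
      · rw [Set.indicator_of_mem hg]
        exact Finset.prod_congr rfl fun j _ => (Set.indicator_of_mem (hg j trivial) _).symm
      · rw [Set.indicator_of_notMem hg]
        simp only [Set.mem_univ_pi, not_forall] at hg
        obtain ⟨j, hj⟩ := hg
        exact (Finset.prod_eq_zero (Finset.mem_univ j) (Set.indicator_of_notMem hj _)).symm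
    rw [e, lintegral_prod_eq_prod_lintegral_of_indepFun Finset.univ
      (fun j (g : J → E) => (s j).indicator (f j) (g j))
      (iIndepFun_pi fun j => ((hf j).indicator (hs j)).aemeasurable)
      fun j => ((hf j).indicator (hs j)).comp (measurable_pi_apply j)]
    refine Finset.prod_congr rfl fun j _ => ?_
    have := (measurePreserving_eval μ j).lintegral_comp ((hf j).indicator (hs j))
    refine this.trans ?_
    rw [lintegral_indicator (hs j), ← withDensity_apply _ (hs j), h j]
    rfl
  rw [← h1]
  refine Measure.pi_eq fun s hs => ?_
  rw [Measure.smul_apply, Measure.pi_pi, smul_eq_mul, ← Finset.prod_mul_distrib]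
  rfl

/-- Conditional Poisson counts: joint law of counts and masses on disjoint sets. -/
theorem measure_counts_masses {Ω : Type u} [MeasurableSpace Ω] {P : Measure Ω}
    [IsProbabilityMeasure P] {𝓧 : Type v} [MeasurableSpace 𝓧] {φ : ℝ}
    {G₀ U : Ω → Measure 𝓧} {w : ℕ → Ω → ℝ≥0} {X : ℕ → Ω → 𝓧} {u : ℕ → Ω → ℕ}
    (hw : ∀ k, Measurable (w k)) (hX : ∀ k, Measurable (X k)) (hG₀ : Measurable G₀)
    (hG₀_eq : ∀ᵐ ω ∂P, G₀ ω = atomicMeasure (w · ω) (X · ω))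
    (hu : IsCondPoisson u w X φ P)
    (hU_eq : ∀ᵐ ω ∂P, U ω = atomicMeasure (fun k => (u k ω : ℝ≥0)) (X · ω))
    (hfin : ∀ᵐ ω ∂P, G₀ ω Set.univ ≠ ∞)
    {J : Type*} [Fintype J] {A : J → Set 𝓧} (hA : ∀ j, MeasurableSet (A j))
    (hd : Pairwise (Function.onFun Disjoint A)) (n : J → ℕ) {T : Set (J → ℝ≥0∞)}
    (hT : MeasurableSet T) :
    P {ω | (∀ j, U ω (A j) = n j) ∧ (fun j => G₀ ω (A j)) ∈ T} =
      ∫⁻ ω in {ω | (fun j => G₀ ω (A j)) ∈ T},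
        ∏ j, poissonMeasure (φ.toNNReal * (G₀ ω (A j)).toNNReal) {n j} ∂P := by
  classical
  set Z : Ω → ℕ → ℝ≥0 × 𝓧 := fun ω k => (w k ω, X k ω) with hZdef
  have hZ : Measurable Z := measurable_pi_lambda _ fun k => (hw k).prodMk (hX k)
  have hV : Measurable fun ω k => u k ω := measurable_pi_lambda _ hu.1
  set g : (ℕ → ℝ≥0 × 𝓧) → J → ℝ≥0∞ := fun z j =>
    atomicMeasure (fun k => (z k).1) (fun k => (z k).2) (A j) with hg
  have hgm : Measurable g := measurable_pi_lambda _ fun j =>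
    (Measure.measurable_coe (hA j)).comp (measurable_atomicMeasure (by fun_prop) (by fun_prop))
  set S : Set ((ℕ → ℝ≥0 × 𝓧) × (ℕ → ℕ)) := {p | (fun j =>
    atomicMeasure (fun k => (p.2 k : ℝ≥0)) (fun k => (p.1 k).2) (A j)) = (fun j => (n j : ℝ≥0∞)) ∧
    g p.1 ∈ T} with hS
  have hSm : MeasurableSet S := by
    refine MeasurableSet.inter ?_ ((hgm.comp measurable_fst) hT)
    have : Measurable fun (p : (ℕ → ℝ≥0 × 𝓧) × (ℕ → ℕ)) (j : J) =>
        atomicMeasure (fun k => (p.2 k : ℝ≥0)) (fun k => (p.1 k).2) (A j) :=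
      measurable_pi_lambda _ fun j => (Measure.measurable_coe (hA j)).comp
        (measurable_atomicMeasure (by fun_prop) (by fun_prop))
    exact this (measurableSet_singleton _)
  have e1 : P {ω | (∀ j, U ω (A j) = n j) ∧ (fun j => G₀ ω (A j)) ∈ T} =
      P ((fun ω => (Z ω, fun k => u k ω)) ⁻¹' S) := by
    refine measure_congr ?_
    filter_upwards [hG₀_eq, hU_eq] with ω h1 h2
    refine propext ?_
    change ((∀ j, U ω (A j) = n j) ∧ (fun j => G₀ ω (A j)) ∈ T) ↔ _ ∧ _
    rw [h1, h2, funext_iff]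
  rw [e1, ← Measure.map_apply (hZ.prodMk hV) hSm, hu.map_eq_compProd hw hX,
    Measure.compProd_apply hSm, lintegral_map (Kernel.measurable_kernel_prodMk_left hSm) hZ]
  have hTm : MeasurableSet {ω | (fun j => G₀ ω (A j)) ∈ T} :=
    (measurable_pi_lambda _ fun j => (Measure.measurable_coe (hA j)).comp hG₀) hT
  rw [← lintegral_indicator hTm]
  refine lintegral_congr_ae ?_
  filter_upwards [hG₀_eq, hfin] with ω h1 h2
  have hgG : g (Z ω) = fun j => G₀ ω (A j) := by rw [h1]
  -- With masses and locations fixed, the condition on `T` is deterministic: the fibre of the event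
  -- is either the block-count event or empty.
  by_cases hmem : (fun j => G₀ ω (A j)) ∈ T
  · rw [Set.indicator_of_mem (by exact hmem)]
    have hf : ∀ j, G₀ ω (A j) = ∑' k, if X k ω ∈ A j then (w k ω : ℝ≥0∞) else 0 := fun j => by
      rw [h1, atomicMeasure_apply _ _ (hA j)]
    have hsum : ∀ j, φ.toNNReal * (G₀ ω (A j)).toNNReal =
        (∑' k, if X k ω ∈ A j then ((φ.toNNReal * w k ω : ℝ≥0) : ℝ≥0∞) else 0).toNNReal := by
      intro j
      rw [hf, ← ENNReal.toNNReal_coe φ.toNNReal, ← ENNReal.toNNReal_mul, ← ENNReal.tsum_mul_left]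
      simp [mul_ite]
    have hb := infinitePi_poisson_block (fun k => φ.toNNReal * w k ω) (fun k j => X k ω ∈ A j)
      (fun k i j hi hj => by
        by_contra hij
        exact Set.disjoint_left.1 (hd hij) hi hj) (fun j => by
        have hlt : G₀ ω (A j) ≠ ∞ := ne_top_of_le_ne_top h2 (measure_mono (Set.subset_univ _))
        have : (∑' k, if X k ω ∈ A j then ((φ.toNNReal * w k ω : ℝ≥0) : ℝ≥0∞) else 0) =
            φ.toNNReal * G₀ ω (A j) := by
          rw [hf, ← ENNReal.tsum_mul_left]
          simp [mul_ite]
        rw [this]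
        exact ENNReal.mul_ne_top ENNReal.coe_ne_top hlt) n
    simp only [← hsum] at hb
    rw [← hb]
    change Measure.infinitePi (fun k => poissonMeasure (φ.toNNReal * w k ω)) _ = _
    congr 1
    ext v
    change _ ∧ _ ↔ ∀ j, _ = _
    rw [hgG, and_iff_left hmem, funext_iff]
    refine forall_congr' fun j => ?_
    rw [atomicMeasure_apply _ _ (hA j)]
    simp
    rfl
  · rw [Set.indicator_of_notMem (by exact hmem)]
    convert measure_empty (μ := poissonCountKernel 𝓧 φ (Z ω))
    ext v
    simp only [Set.mem_empty_iff_false, iff_false]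
    rintro ⟨-, h⟩
    rw [hgG] at h
    exact hmem h

theorem IsGammaProcess.hasLaw_pi {Ω : Type u} [MeasurableSpace Ω] {P : Measure Ω}
    [IsProbabilityMeasure P] {𝓧 : Type v} [MeasurableSpace 𝓧] {α τ : ℝ} {H : Measure 𝓧}
    {G : Ω → Measure 𝓧} (hG : IsGammaProcess G α τ H P)
    {J : Type*} [Fintype J] {A : J → Set 𝓧} (hA : ∀ j, MeasurableSet (A j))
    (hd : Pairwise (Function.onFun Disjoint A)) :
    iIndepFun (fun j ω => G ω (A j)) P ∧ HasLaw (fun ω j => G ω (A j))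
      (Measure.pi fun j => gammaLawENNReal (α * H.real (A j)) τ) P := by
  have e := Fintype.equivFin J
  have h := hG.indep _ (fun i => A (e.symm i)) (fun i => hA _)
    (fun i j hij => hd (e.symm.injective.ne hij))
  have h' := h.precomp e.injective
  simp only [Equiv.symm_apply_apply] at h'
  exact ⟨h', h'.hasLaw_pi fun j => hG.marginal (A j) (hA j)⟩

theorem IsGammaProcess.ae_univ_ne_top {Ω : Type u} [MeasurableSpace Ω] {P : Measure Ω}
    {𝓧 : Type v} [MeasurableSpace 𝓧] {α τ : ℝ} {H : Measure 𝓧}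
    {G : Ω → Measure 𝓧} (hG : IsGammaProcess G α τ H P) : ∀ᵐ ω ∂P, G ω Set.univ ≠ ∞ := by
  have h := hG.marginal Set.univ .univ
  refine ae_iff.2 ?_
  simp only [not_not]
  rw [h.measure_eq (p := fun x => x = ∞) (measurableSet_singleton _)]
  exact gammaLawENNReal_singleton_top _ _

/-- Finite-dimensional form of the posterior: given the counts on disjoint sets, the masses are
independent gamma variables with updated parameters. -/
theorem measure_counts_gamma {Ω : Type u} [MeasurableSpace Ω] {P : Measure Ω}
    [IsProbabilityMeasure P] {𝓧 : Type v} [MeasurableSpace 𝓧] {H : Measure 𝓧}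
    {α τ φ : ℝ} (hα : 0 < α) (hτ : 0 < τ) (hφ : 0 < φ)
    {G₀ U : Ω → Measure 𝓧} {w : ℕ → Ω → ℝ≥0} {X : ℕ → Ω → 𝓧} {u : ℕ → Ω → ℕ}
    (hw : ∀ k, Measurable (w k)) (hX : ∀ k, Measurable (X k))
    (hG₀ : IsGammaProcess G₀ α τ H P)
    (hG₀_eq : ∀ᵐ ω ∂P, G₀ ω = atomicMeasure (w · ω) (X · ω))
    (hu : IsCondPoisson u w X φ P)
    (hU_eq : ∀ᵐ ω ∂P, U ω = atomicMeasure (fun k => (u k ω : ℝ≥0)) (X · ω))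
    {J : Type*} [Fintype J] {A : J → Set 𝓧} (hA : ∀ j, MeasurableSet (A j))
    (hd : Pairwise (Function.onFun Disjoint A)) (n : J → ℕ) {T : Set (J → ℝ≥0∞)}
    (hT : MeasurableSet T) :
    P {ω | (∀ j, U ω (A j) = n j) ∧ (fun j => G₀ ω (A j)) ∈ T} =
      P {ω | ∀ j, U ω (A j) = n j} *
        Measure.pi (fun j => gammaLawENNReal (α * H.real (A j) + n j) (τ + φ)) T := by
  have ha : ∀ j, 0 ≤ α * H.real (A j) := fun j => mul_nonneg hα.le measureReal_nonneg
  have := fun j => isProbabilityMeasure_gammaLawENNReal (ha j) hτ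
  have := fun j => isProbabilityMeasure_gammaLawENNReal (add_nonneg (ha j) (n j).cast_nonneg)
    (add_pos hτ hφ)
  have hC : ∀ j, ∃ C : ℝ≥0, (gammaLawENNReal (α * H.real (A j)) τ).withDensity
      (fun g => poissonMeasure (φ.toNNReal * g.toNNReal) {n j}) =
      (C : ℝ≥0∞) • gammaLawENNReal (α * H.real (A j) + n j) (τ + φ) := by
    intro j
    obtain ⟨C, hC⟩ := gammaLawENNReal_withDensity_poisson (ha j) hτ hφ (n j)
    have h1 := congrArg (fun μ => μ Set.univ) hC
    simp only [withDensity_apply _ MeasurableSet.univ, Measure.smul_apply, measure_univ,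
      smul_eq_mul, mul_one, Measure.restrict_univ] at h1
    -- The constant is the marginal probability of the count, hence at most one.
    have : C ≠ ∞ := by
      rw [← h1]
      refine ne_top_of_le_ne_top ENNReal.one_ne_top ((lintegral_mono fun g => prob_le_one).trans ?_)
      simp
    lift C to ℝ≥0 using this
    exact ⟨C, hC⟩
  choose C hC using hC
  have hfm : ∀ j, Measurable fun g : ℝ≥0∞ => poissonMeasure (φ.toNNReal * g.toNNReal) {n j} :=
    fun j => by simp only [poissonMeasure_singleton]; fun_prop
  have hden := pi_withDensity_of_eq_smul _ _ _ hfm C hC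
  have key : ∀ T : Set (J → ℝ≥0∞), MeasurableSet T →
      P {ω | (∀ j, U ω (A j) = n j) ∧ (fun j => G₀ ω (A j)) ∈ T} =
      (∏ j, (C j : ℝ≥0∞)) *
        Measure.pi (fun j => gammaLawENNReal (α * H.real (A j) + n j) (τ + φ)) T := by
    intro T hT
    rw [measure_counts_masses hw hX hG₀.measurable hG₀_eq hu hU_eq hG₀.ae_univ_ne_top hA hd n hT,
      ← smul_eq_mul, ← Measure.smul_apply, ← hden, withDensity_apply _ hT,
      ← (hG₀.hasLaw_pi hA hd).2.map_eq, setLIntegral_map hT]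
    · rfl
    · exact Finset.measurable_prod _ fun j _ => (hfm j).comp (measurable_pi_apply j)
    · exact measurable_pi_lambda _ fun j => (Measure.measurable_coe (hA j)).comp hG₀.measurable
  -- Taking `T` to be everything identifies the product of constants with the probability of the
  -- observed counts.
  have h2 := key Set.univ .univ
  simp only [Set.mem_univ, and_true, measure_univ, mul_one] at h2
  rw [key T hT, h2]

theorem finite_pos_of_atomicMeasure_univ {𝓧 : Type v} [MeasurableSpace 𝓧] {n : ℕ → ℕ}
    {x : ℕ → 𝓧} (h : atomicMeasure (fun k => (n k : ℝ≥0)) x Set.univ ≠ ∞) :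
    {k | 0 < n k}.Finite := by
  classical
  rw [atomicMeasure_apply _ _ .univ] at h
  simp only [Set.mem_univ, if_true] at h
  refine (ENNReal.finite_const_le_of_tsum_ne_top h one_ne_zero).subset fun k hk => ?_
  have hk : 0 < n k := hk
  change (1 : ℝ≥0∞) ≤ _
  exact_mod_cast hk

/-- With the whole space as a single block, the total count is Poisson with a finite random mean.
Its point probabilities sum to one, so the total is almost surely a natural number, and only
finitely many integer summands can be positive. -/
theorem IsCondPoisson.ae_finite {Ω : Type u} [MeasurableSpace Ω] {P : Measure Ω}
    [IsProbabilityMeasure P] {𝓧 : Type v} [MeasurableSpace 𝓧] {φ : ℝ}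
    {G₀ U : Ω → Measure 𝓧} {w : ℕ → Ω → ℝ≥0} {X : ℕ → Ω → 𝓧} {u : ℕ → Ω → ℕ}
    (hw : ∀ k, Measurable (w k)) (hX : ∀ k, Measurable (X k)) (hU : Measurable U)
    (hG₀ : Measurable G₀)
    (hG₀_eq : ∀ᵐ ω ∂P, G₀ ω = atomicMeasure (w · ω) (X · ω))
    (hu : IsCondPoisson u w X φ P)
    (hU_eq : ∀ᵐ ω ∂P, U ω = atomicMeasure (fun k => (u k ω : ℝ≥0)) (X · ω))
    (hfin : ∀ᵐ ω ∂P, G₀ ω Set.univ ≠ ∞) :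
    ∀ᵐ ω ∂P, {k | 0 < u k ω}.Finite := by
  have h (n : ℕ) := measure_counts_masses hw hX hG₀ hG₀_eq hu hU_eq hfin
    (J := Unit) (A := fun _ => Set.univ) (fun _ => .univ) (fun i j h => (h rfl).elim)
    (fun _ => n) (T := Set.univ) .univ
  simp only [Set.mem_univ, and_true, forall_const, Finset.univ_unique, Finset.prod_singleton,
    Set.ofPred_true, Measure.restrict_univ] at h
  have hG : Measurable fun ω => G₀ ω Set.univ := (Measure.measurable_coe .univ).comp hG₀
  have hUm : Measurable fun ω => U ω Set.univ := (Measure.measurable_coe .univ).comp hU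
  have hm (n : ℕ) : MeasurableSet {ω | U ω Set.univ = n} := hUm (measurableSet_singleton _)
  have h1 : P (⋃ n : ℕ, {ω | U ω Set.univ = n}) = 1 := by
    rw [measure_iUnion _ hm]
    · simp only [h]
      rw [← lintegral_tsum fun n => by simp only [poissonMeasure_singleton]; fun_prop]
      have (r : ℝ≥0) : ∑' n, poissonMeasure r {n} = 1 := by
        have h2 := measure_iUnion (μ := poissonMeasure r) (f := fun n : ℕ => {n})
          (fun i j h => by simpa using h) fun n => measurableSet_singleton n
        rw [Set.iUnion_of_singleton, measure_univ] at h2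
        exact h2.symm
      simp [this]
    · refine fun i j hij => Set.disjoint_left.2 fun ω h1 h2 => hij ?_
      have h3 : ((i : ℕ) : ℝ≥0∞) = j := (show U ω Set.univ = i from h1).symm.trans h2
      exact_mod_cast h3
  have h2 : ∀ᵐ ω ∂P, ω ∈ ⋃ n : ℕ, {ω | U ω Set.univ = n} :=
    mem_ae_iff_prob_eq_one (MeasurableSet.iUnion hm) |>.2 h1
  filter_upwards [h2, hU_eq] with ω h3 h4
  obtain ⟨n, hn⟩ := Set.mem_iUnion.1 h3
  refine finite_pos_of_atomicMeasure_univ (x := (X · ω)) ?_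
  rw [← h4, show U ω Set.univ = n from hn]
  exact ENNReal.natCast_ne_top n

/-! ### The urn scheme: gamma masses as a kernel in the counting measure. -/

theorem measurableSet_diagonal_of_countablySeparated (𝓧 : Type v) [MeasurableSpace 𝓧]
    [MeasurableSpace.CountablySeparated 𝓧] : MeasurableSet {p : 𝓧 × 𝓧 | p.1 = p.2} := by
  obtain ⟨f, hf, hinj⟩ := MeasurableSpace.measurable_injection_nat_bool_of_countablySeparated 𝓧
  have : {p : 𝓧 × 𝓧 | p.1 = p.2} = {p | f p.1 = f p.2} := by
    ext p; exact hinj.eq_iff.symm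
  rw [this]
  exact measurableSet_eq_fun (hf.comp measurable_fst) (hf.comp measurable_snd)

/-- Sampling from a normalized measure. -/
noncomputable def normalizedKernel {𝓧 : Type v} [MeasurableSpace 𝓧] (x₀ : 𝓧) :
    Kernel (Measure 𝓧) 𝓧 := by
  classical
  exact {
    toFun := fun m => if m Set.univ = 0 ∨ m Set.univ = ∞ then Measure.dirac x₀ else
      (m Set.univ)⁻¹ • m
    measurable' := by
      have hm : Measurable fun m : Measure 𝓧 => m Set.univ := Measure.measurable_coe .univ
      refine Measurable.ite ?_ measurable_const ?_
      · exact (hm (measurableSet_singleton 0)).union (hm (measurableSet_singleton ∞))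
      · refine Measure.measurable_of_measurable_coe _ fun s hs => ?_
        exact hm.inv.mul (Measure.measurable_coe hs) }

theorem normalizedKernel_apply {𝓧 : Type v} [MeasurableSpace 𝓧] (x₀ : 𝓧) {m : Measure 𝓧}
    (h0 : m Set.univ ≠ 0) (h1 : m Set.univ ≠ ∞) :
    normalizedKernel x₀ m = (m Set.univ)⁻¹ • m := by
  classical
  exact if_neg (by simp [h0, h1])

instance {𝓧 : Type v} [MeasurableSpace 𝓧] (x₀ : 𝓧) : IsMarkovKernel (normalizedKernel x₀) := by
  classical
  refine ⟨fun m => ?_⟩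
  by_cases h : m Set.univ = 0 ∨ m Set.univ = ∞
  · rw [show normalizedKernel x₀ m = Measure.dirac x₀ from if_pos h]
    infer_instance
  · push Not at h
    rw [normalizedKernel_apply x₀ h.1 h.2]
    exact ⟨ENNReal.inv_mul_cancel h.1 h.2⟩

/-- The measure `m - δ_y`, when `m` is finite with an atom of mass at least one at `y`. -/
noncomputable def removeUnitAtom {𝓧 : Type v} [MeasurableSpace 𝓧] (x₀ : 𝓧)
    (p : Measure 𝓧 × 𝓧) : Measure 𝓧 :=
  p.1 Set.univ • (normalizedKernel x₀ p.1).restrict {p.2}ᶜ +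
    (p.1 Set.univ * normalizedKernel x₀ p.1 {p.2} - 1) • Measure.dirac p.2

/-- Measurability of `m {y}` jointly in `m` and `y` rests on the measurable diagonal and on an
s-finite kernel. The map `m ↦ m` need not be one, which is why the normalized Markov kernel is used
and the total mass multiplied back. -/
theorem measurable_removeUnitAtom {𝓧 : Type v} [MeasurableSpace 𝓧]
    [MeasurableSpace.CountablySeparated 𝓧] (x₀ : 𝓧) : Measurable (removeUnitAtom x₀) := by
  have hu : Measurable fun p : Measure 𝓧 × 𝓧 => p.1 Set.univ :=
    (Measure.measurable_coe .univ).comp measurable_fst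
  have hD := measurableSet_diagonal_of_countablySeparated 𝓧
  set K : Kernel (Measure 𝓧 × 𝓧) 𝓧 := (normalizedKernel x₀).comap Prod.fst measurable_fst
  refine Measure.measurable_of_measurable_coe _ fun A hA => ?_
  have h1 : Measurable fun p : Measure 𝓧 × 𝓧 => (normalizedKernel x₀ p.1).restrict {p.2}ᶜ A := by
    have hS : MeasurableSet {q : (Measure 𝓧 × 𝓧) × 𝓧 | q.2 ∈ A ∧ q.2 ≠ q.1.2} :=
      (measurable_snd hA).inter
        ((measurable_snd.prodMk (measurable_snd.comp measurable_fst)) hD).compl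
    convert Kernel.measurable_kernel_prodMk_left (κ := K) hS using 2 with p
    rw [Measure.restrict_apply hA]
    rfl
  have h2 : Measurable fun p : Measure 𝓧 × 𝓧 => normalizedKernel x₀ p.1 {p.2} := by
    have hS : MeasurableSet {q : (Measure 𝓧 × 𝓧) × 𝓧 | q.2 = q.1.2} :=
      (measurable_snd.prodMk (measurable_snd.comp measurable_fst)) hD
    exact Kernel.measurable_kernel_prodMk_left (κ := K) hS
  have h3 : Measurable fun p : Measure 𝓧 × 𝓧 => Measure.dirac p.2 A :=
    (Measure.measurable_coe hA).comp (Measure.measurable_dirac.comp measurable_snd)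
  exact (hu.mul h1).add (((hu.mul h2).sub measurable_const).mul h3)

theorem removeUnitAtom_eq {𝓧 : Type v} [MeasurableSpace 𝓧] [MeasurableSingletonClass 𝓧] (x₀ y : 𝓧)
    (ν : Measure 𝓧) [IsFiniteMeasure ν] : removeUnitAtom x₀ (ν + Measure.dirac y, y) = ν := by
  have h0 : (ν + Measure.dirac y) Set.univ ≠ 0 := by simp
  have h1 : (ν + Measure.dirac y) Set.univ ≠ ∞ := measure_ne_top _ _
  ext A hA
  rw [removeUnitAtom]
  simp only
  rw [normalizedKernel_apply x₀ h0 h1, Measure.restrict_smul, smul_smul,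
    ENNReal.mul_inv_cancel h0 h1, one_smul, Measure.smul_apply, smul_eq_mul, ← mul_assoc,
    ENNReal.mul_inv_cancel h0 h1, one_mul, Measure.add_apply, Measure.restrict_apply hA,
    Measure.add_apply, Measure.smul_apply, Measure.add_apply,
    Measure.dirac_apply' _ (hA.inter (measurableSet_singleton y).compl),
    Measure.dirac_apply' _ (measurableSet_singleton y)]
  simp only [Set.mem_inter_iff, Set.mem_compl_iff, Set.mem_singleton_iff, not_true, and_false,
    not_false_eq_true, Set.indicator_of_notMem, add_zero, Set.indicator_of_mem, Pi.one_apply,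
    ENNReal.add_sub_cancel_right ENNReal.one_ne_top]
  rw [← measure_inter_add_sdiff (μ := ν) A (measurableSet_singleton y), add_comm (ν (A ∩ {y})),
    Set.sdiff_eq,
    smul_eq_mul, Measure.dirac_apply' _ hA]
  congr 1
  by_cases h : y ∈ A
  · simp [h, Set.inter_eq_right.2 (Set.singleton_subset_iff.2 h)]
  · simp [h]

/-- The law of `∑ₖ wₖ δ_{xₖ}` with independent `wₖ ∼ Gamma(nₖ, r)`. -/
noncomputable def gammaAtomLaw {𝓧 : Type v} [MeasurableSpace 𝓧] (r : ℝ) (n : ℕ → ℕ) (x : ℕ → 𝓧) :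
    Measure (Measure 𝓧) :=
  (Measure.infinitePi fun k => gammaLaw (n k) r).map fun w => atomicMeasure w x

/-- Iteratively draw an atom of an integer-valued measure, remove one unit of its mass, and give
it an additional `Gamma(1, r)` mass. -/
noncomputable def gammaUrnKernel {𝓧 : Type v} [MeasurableSpace 𝓧]
    [MeasurableSpace.CountablySeparated 𝓧] (x₀ : 𝓧) (r : ℝ) :
    ℕ → Kernel (Measure 𝓧) (Measure 𝓧)
  | 0 => Kernel.const _ (Measure.dirac 0)
  | N + 1 =>
    ((((gammaUrnKernel x₀ r N).comap (removeUnitAtom x₀) (measurable_removeUnitAtom x₀)) ×ₖ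
      ((Kernel.const (Measure 𝓧 × 𝓧) (gammaLaw 1 r)) ×ₖ
        Kernel.deterministic Prod.snd measurable_snd)).map
      fun q => q.1 + (q.2.1 : ℝ≥0∞) • Measure.dirac q.2.2) ∘ₖ
      (Kernel.id ×ₖ normalizedKernel x₀)

theorem measurable_add_smul_dirac (𝓧 : Type v) [MeasurableSpace 𝓧] :
    Measurable fun q : Measure 𝓧 × ℝ≥0 × 𝓧 => q.1 + (q.2.1 : ℝ≥0∞) • Measure.dirac q.2.2 := by
  refine Measure.measurable_of_measurable_coe _ fun A hA => ?_
  have h1 : Measurable fun q : Measure 𝓧 × ℝ≥0 × 𝓧 => q.1 A :=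
    (Measure.measurable_coe hA).comp measurable_fst
  have h2 : Measurable fun q : Measure 𝓧 × ℝ≥0 × 𝓧 => Measure.dirac q.2.2 A :=
    (Measure.measurable_coe hA).comp
      (Measure.measurable_dirac.comp (measurable_snd.comp measurable_snd))
  have h3 : Measurable fun q : Measure 𝓧 × ℝ≥0 × 𝓧 => (q.2.1 : ℝ≥0∞) := by fun_prop
  exact h1.add (h3.mul h2)

theorem prod_map_right {α β γ : Type*} [MeasurableSpace α] [MeasurableSpace β] [MeasurableSpace γ]
    (μ : Measure α) (ν : Measure β) [SFinite μ] [SFinite ν] {g : β → γ} (hg : Measurable g) :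
    μ.prod (ν.map g) = (μ.prod ν).map (Prod.map id g) := by
  rw [← Measure.map_prod_map _ _ measurable_id hg, Measure.map_id]

theorem prod_map_left {α β γ : Type*} [MeasurableSpace α] [MeasurableSpace β] [MeasurableSpace γ]
    (μ : Measure α) (ν : Measure β) [SFinite μ] [SFinite ν] {f : α → γ} (hf : Measurable f) :
    (μ.map f).prod ν = (μ.prod ν).map (Prod.map f id) := by
  rw [← Measure.map_prod_map _ _ hf measurable_id, Measure.map_id]

theorem atomicMeasure_add_ite {𝓧 : Type v} [MeasurableSpace 𝓧] (x : ℕ → 𝓧) (w : ℕ → ℝ≥0) (e : ℝ≥0) (j : ℕ) :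
    atomicMeasure (fun k => w k + if k = j then e else 0) x =
      atomicMeasure w x + (e : ℝ≥0∞) • Measure.dirac (x j) := by
  classical
  ext A hA
  rw [Measure.add_apply, Measure.smul_apply, Measure.dirac_apply' _ hA, atomicMeasure_apply _ _ hA,
    atomicMeasure_apply _ _ hA]
  have h (k : ℕ) : (if x k ∈ A then ((w k + if k = j then e else 0 : ℝ≥0) : ℝ≥0∞) else 0) =
      (if x k ∈ A then (w k : ℝ≥0∞) else 0) +
        if k = j then (if x k ∈ A then (e : ℝ≥0∞) else 0) else 0 := by
    split_ifs <;> simp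
  simp only [h]
  rw [ENNReal.tsum_add, tsum_ite_eq]
  by_cases hj : x j ∈ A <;> simp [hj]

theorem isProbabilityMeasure_gammaAtomLaw {𝓧 : Type v} [MeasurableSpace 𝓧]
    {r : ℝ} (hr : 0 < r) (n : ℕ → ℕ) (x : ℕ → 𝓧) :
    IsProbabilityMeasure (gammaAtomLaw r n x) := by
  have hn (k : ℕ) : IsProbabilityMeasure (gammaLaw (n k) r) :=
    isProbabilityMeasure_gammaLaw (n k).cast_nonneg hr
  exact Measure.isProbabilityMeasure_map
    (measurable_atomicMeasure (fun k => by fun_prop) fun k => measurable_const).aemeasurable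

/-- The inductive step of the urn: Gamma(n, r) and an independent Gamma(1, r) add up to Gamma(n + 1,
r) at index `j`, with the other indices unchanged. -/
theorem map_atomicMeasure_add {𝓧 : Type v} [MeasurableSpace 𝓧] (x : ℕ → 𝓧) {r : ℝ} (hr : 0 < r) (n : ℕ → ℕ) (j : ℕ) :
    ((gammaAtomLaw r n x).prod (gammaLaw 1 r)).map
      (fun p => p.1 + (p.2 : ℝ≥0∞) • Measure.dirac (x j)) =
      gammaAtomLaw r (fun k => n k + if k = j then 1 else 0) x := by
  have h1 := isProbabilityMeasure_gammaLaw zero_le_one hr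
  have hn (n : ℕ) : IsProbabilityMeasure (gammaLaw n r) :=
    isProbabilityMeasure_gammaLaw n.cast_nonneg hr
  have hi (k : ℕ) : IsProbabilityMeasure (if k = j then gammaLaw 1 r else Measure.dirac 0) := by
    split_ifs <;> infer_instance
  have hF : Measurable fun w : ℕ → ℝ≥0 => atomicMeasure w x :=
    measurable_atomicMeasure (fun k => by fun_prop) fun k => measurable_const
  have hg : Measurable fun (e : ℝ≥0) (k : ℕ) => if k = j then e else 0 :=
    measurable_pi_lambda _ fun k => by split_ifs <;> fun_prop
  have hM : Measurable fun p : Measure 𝓧 × ℝ≥0 => p.1 + (p.2 : ℝ≥0∞) • Measure.dirac (x j) :=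
    (measurable_add_smul_dirac 𝓧).comp
      (measurable_fst.prodMk (measurable_snd.prodMk measurable_const))
  have hadd : Measurable fun p : (ℕ → ℝ≥0) × (ℕ → ℝ≥0) => p.1 + p.2 :=
    measurable_pi_lambda _ fun k => by simp only [Pi.add_apply]; fun_prop
  have hpg : Measurable fun (p : (ℕ → ℝ≥0) × ℝ≥0) (k : ℕ) => p.1 k + if k = j then p.2 else 0 :=
    measurable_pi_lambda _ fun k => by split_ifs <;> fun_prop
  have e1 : (Measure.infinitePi fun k => gammaLaw ((n k + if k = j then 1 else 0 : ℕ) : ℝ) r) =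
      ((Measure.infinitePi fun k => gammaLaw (n k) r).prod (gammaLaw 1 r)).map
        fun p k => p.1 k + if k = j then p.2 else 0 := by
    have h2 := infinitePi_conv_infinitePi (fun k => gammaLaw (n k) r)
      fun k => if k = j then gammaLaw 1 r else Measure.dirac 0
    rw [← map_ite_eq_infinitePi (gammaLaw 1 r) (fun k => k = j) (fun a b ha hb => ha.trans hb.symm),
      prod_map_right _ _ hg, Measure.map_map hadd (measurable_id.prodMap hg)] at h2
    refine Eq.trans ?_ h2.symm
    congr 1
    ext1 k
    split_ifs
    · rw [gammaLaw_conv (n k).cast_nonneg zero_le_one hr]; simp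
    · rw [Measure.conv_dirac_zero]; simp
  rw [gammaAtomLaw, gammaAtomLaw, e1, prod_map_left _ _ hF,
    Measure.map_map hM (by fun_prop), Measure.map_map hF hpg]
  congr 1
  ext1 p
  exact (atomicMeasure_add_ite x p.1 p.2 j).symm

section Urn

variable {𝓧 : Type v} [MeasurableSpace 𝓧] [MeasurableSpace.CountablySeparated 𝓧]

theorem isMarkovKernel_gammaUrnKernel (x₀ : 𝓧) {r : ℝ} (hr : 0 < r) (N : ℕ) :
    IsMarkovKernel (gammaUrnKernel x₀ r N) := by
  have := isProbabilityMeasure_gammaLaw zero_le_one hr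
  induction N with
  | zero => rw [gammaUrnKernel]; infer_instance
  | succ N ih =>
    rw [gammaUrnKernel]
    have := Kernel.IsMarkovKernel.map (((gammaUrnKernel x₀ r N).comap (removeUnitAtom x₀)
      (measurable_removeUnitAtom x₀)) ×ₖ ((Kernel.const (Measure 𝓧 × 𝓧) (gammaLaw 1 r)) ×ₖ
        Kernel.deterministic Prod.snd measurable_snd)) (measurable_add_smul_dirac 𝓧)
    infer_instance

theorem gammaUrnKernel_succ_apply (x₀ : 𝓧) {r : ℝ} (hr : 0 < r) (N : ℕ) (m : Measure 𝓧) :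
    gammaUrnKernel x₀ r (N + 1) m = (normalizedKernel x₀ m).bind fun y =>
      ((gammaUrnKernel x₀ r N (removeUnitAtom x₀ (m, y))).prod (gammaLaw 1 r)).map
        fun p => p.1 + (p.2 : ℝ≥0∞) • Measure.dirac y := by
  have := isProbabilityMeasure_gammaLaw zero_le_one hr
  have := isMarkovKernel_gammaUrnKernel x₀ hr N
  have hM := measurable_add_smul_dirac 𝓧
  rw [gammaUrnKernel, Kernel.comp_apply, Kernel.prod_apply, Kernel.id_apply, Measure.dirac_prod,
    Measure.bind, Measure.map_map (Kernel.measurable _) (by fun_prop), Measure.bind]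
  congr 2
  ext1 y
  rw [Function.comp, Kernel.map_apply _ hM, Kernel.prod_apply, Kernel.prod_apply,
    Kernel.comap_apply, Kernel.const_apply, Kernel.deterministic_apply, Measure.prod_dirac,
    prod_map_right _ _ (by fun_prop), Measure.map_map hM (by fun_prop)]
  rfl

/-- Induction on the total mass. Whichever atom is drawn first, the remaining draws and the extra
Gamma(1, r) mass recombine to the same law, so mixing over the draw has no effect. If several
indices share a location, any one of positive count may be decremented. -/
theorem gammaUrnKernel_apply (x₀ : 𝓧) {r : ℝ} (hr : 0 < r) (x : ℕ → 𝓧) (N : ℕ) (n : ℕ → ℕ)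
    (hn : atomicMeasure (fun k => (n k : ℝ≥0)) x Set.univ = N) :
    gammaUrnKernel x₀ r N (atomicMeasure (fun k => (n k : ℝ≥0)) x) = gammaAtomLaw r n x := by
  classical
  have := MeasurableSpace.measurableSingletonClass_of_countablySeparated (α := 𝓧)
  have := isProbabilityMeasure_gammaLaw zero_le_one hr
  induction N generalizing n with
  | zero =>
    rw [atomicMeasure_apply _ _ .univ] at hn
    simp only [Set.mem_univ, if_true, Nat.cast_zero, ENNReal.tsum_eq_zero] at hn
    have hn0 : ∀ k, n k = 0 := fun k => by simpa using hn k
    have hF : Measurable fun w : ℕ → ℝ≥0 => atomicMeasure w x :=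
      measurable_atomicMeasure (fun k => by fun_prop) fun k => measurable_const
    rw [gammaUrnKernel, Kernel.const_apply, gammaAtomLaw]
    simp only [hn0, Nat.cast_zero, gammaLaw_zero, Measure.infinitePi_dirac]
    rw [Measure.map_dirac' hF]
    congr 1
    ext A hA
    rw [atomicMeasure_apply _ _ hA]
    simp
  | succ N ih =>
    set m := atomicMeasure (fun k => (n k : ℝ≥0)) x with hm
    have h0 : m Set.univ ≠ 0 := by rw [hn]; simp
    have h1 : m Set.univ ≠ ∞ := by rw [hn]; exact ENNReal.natCast_ne_top _
    have hae : ∀ᵐ y ∂normalizedKernel x₀ m, ∃ j, 0 < n j ∧ x j = y := by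
      rw [normalizedKernel_apply x₀ h0 h1]
      refine Measure.ae_smul_measure ?_ _
      have hS : MeasurableSet {y | ∃ j, 0 < n j ∧ x j = y} :=
        ((Set.to_countable {j | 0 < n j}).image x).measurableSet
      rw [ae_iff]
      change m {y | ∃ j, 0 < n j ∧ x j = y}ᶜ = 0
      rw [hm, atomicMeasure_apply _ _ hS.compl, ENNReal.tsum_eq_zero]
      intro k
      split_ifs with hk
      · by_contra hne
        exact hk ⟨k, Nat.pos_of_ne_zero fun h => hne (by simp [h]), rfl⟩
      · rfl
    rw [gammaUrnKernel_succ_apply x₀ hr]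
    have hc : (fun y => ((gammaUrnKernel x₀ r N (removeUnitAtom x₀ (m, y))).prod
        (gammaLaw 1 r)).map fun p => p.1 + (p.2 : ℝ≥0∞) • Measure.dirac y) =ᵐ[normalizedKernel x₀ m]
        fun _ => gammaAtomLaw r n x := by
      filter_upwards [hae] with y ⟨j, hj, hy⟩
      subst hy
      set n' : ℕ → ℕ := fun k => n k - if k = j then 1 else 0
      have hnn : n = fun k => n' k + if k = j then 1 else 0 := by
        ext k
        simp only [n']
        split_ifs with h
        · subst h; omega
        · simp
      have hmm : m = atomicMeasure (fun k => (n' k : ℝ≥0)) x + Measure.dirac (x j) := by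
        have := atomicMeasure_add_ite x (fun k => (n' k : ℝ≥0)) 1 j
        rw [ENNReal.coe_one, one_smul] at this
        rw [← this, hm]
        congr 1
        ext1 k
        rw [congrFun hnn k]
        push_cast
        split_ifs <;> simp
      have hN : atomicMeasure (fun k => (n' k : ℝ≥0)) x Set.univ = N := by
        rw [hmm, Measure.add_apply, measure_univ (μ := Measure.dirac (x j)), Nat.cast_add,
          Nat.cast_one] at hn
        exact (ENNReal.add_left_inj ENNReal.one_ne_top).1 hn
      have : IsFiniteMeasure (atomicMeasure (fun k => (n' k : ℝ≥0)) x) :=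
        ⟨by rw [hN]; exact ENNReal.natCast_lt_top _⟩
      have hr' := removeUnitAtom_eq x₀ (x j) (atomicMeasure (fun k => (n' k : ℝ≥0)) x)
      rw [← hmm] at hr'
      rw [hr', ih n' hN, map_atomicMeasure_add x hr, ← hnn]
    rw [Measure.bind_congr_right hc, Measure.bind_const, measure_univ, one_smul]

/-- Random gamma masses on the unit atoms of an integer-valued measure. -/
noncomputable def gammaAtomKernel (x₀ : 𝓧) (r : ℝ) : Kernel (Measure 𝓧) (Measure 𝓧) where
  toFun m := gammaUrnKernel x₀ r ⌊(m Set.univ).toNNReal⌋₊ m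
  measurable' := by
    -- The number of draws is read off from the total mass; it takes countably many values, so
    -- measurability may be checked for each separately.
    have h1 : Measurable fun p : ℕ × Measure 𝓧 => gammaUrnKernel x₀ r p.1 p.2 :=
      measurable_from_prod_countable_right fun N => (gammaUrnKernel x₀ r N).measurable
    have h2 : Measurable fun m : Measure 𝓧 => ⌊(m Set.univ).toNNReal⌋₊ :=
      Nat.measurable_floor.comp (Measure.measurable_coe .univ).ennreal_toNNReal
    exact h1.comp (h2.prodMk measurable_id)

theorem isMarkovKernel_gammaAtomKernel (x₀ : 𝓧) {r : ℝ} (hr : 0 < r) :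
    IsMarkovKernel (gammaAtomKernel x₀ r) :=
  ⟨fun m => (isMarkovKernel_gammaUrnKernel x₀ hr _).isProbabilityMeasure m⟩

theorem gammaAtomKernel_apply (x₀ : 𝓧) {r : ℝ} (hr : 0 < r) (x : ℕ → 𝓧) (n : ℕ → ℕ)
    (hn : {k | 0 < n k}.Finite) :
    gammaAtomKernel x₀ r (atomicMeasure (fun k => (n k : ℝ≥0)) x) = gammaAtomLaw r n x := by
  classical
  have h : atomicMeasure (fun k => (n k : ℝ≥0)) x Set.univ =
      ((∑ k ∈ hn.toFinset, n k : ℕ) : ℝ≥0∞) := by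
    rw [atomicMeasure_apply _ _ .univ, tsum_eq_sum (s := hn.toFinset)]
    · simp
    · intro k hk
      have : n k = 0 := by simpa using hk
      simp [this]
  change gammaUrnKernel x₀ r ⌊(atomicMeasure (fun k => (n k : ℝ≥0)) x Set.univ).toNNReal⌋₊ _ = _
  rw [show ⌊(atomicMeasure (fun k => (n k : ℝ≥0)) x Set.univ).toNNReal⌋₊ =
    ∑ k ∈ hn.toFinset, n k by rw [h, ENNReal.toNNReal_natCast, Nat.floor_natCast]]
  exact gammaUrnKernel_apply x₀ hr x _ n h

end Urn

/-! ### Atoms of gamma processes. -/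

theorem atomSet_atomicMeasure {𝓧 : Type v} [MeasurableSpace 𝓧] [MeasurableSingletonClass 𝓧]
    (w : ℕ → ℝ≥0) (x : ℕ → 𝓧) : atomSet (atomicMeasure w x) = x '' {k | w k ≠ 0} := by
  classical
  ext y
  change 0 < atomicMeasure w x {y} ↔ _
  rw [atomicMeasure_apply _ _ (measurableSet_singleton y), pos_iff_ne_zero, ne_eq,
    ENNReal.tsum_eq_zero, not_forall]
  refine exists_congr fun k => ?_
  simp only [Set.mem_singleton_iff, ite_eq_right_iff, ENNReal.coe_eq_zero, Classical.not_imp,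
    Set.mem_ofPred_eq]
  exact and_comm

theorem IsGammaProcess.ae_pos {Ω : Type u} [MeasurableSpace Ω] {P : Measure Ω}
    {𝓧 : Type v} [MeasurableSpace 𝓧] {α τ : ℝ} {H : Measure 𝓧} [IsFiniteMeasure H] (hα : 0 < α)
    {G : Ω → Measure 𝓧} (hG : IsGammaProcess G α τ H P) {A : Set 𝓧} (hA : MeasurableSet A)
    (hH : H A ≠ 0) : ∀ᵐ ω ∂P, 0 < G ω A := by
  have h := hG.marginal A hA
  refine ae_iff.2 ?_
  simp only [not_lt, nonpos_iff_eq_zero]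
  rw [h.measure_eq (p := fun x => x = 0) (measurableSet_singleton _)]
  exact gammaLawENNReal_singleton_zero
    (mul_pos hα (ENNReal.toReal_pos hH (measure_ne_top _ _)))

theorem IsGammaProcess.ae_eq_zero {Ω : Type u} [MeasurableSpace Ω] {P : Measure Ω}
    {𝓧 : Type v} [MeasurableSpace 𝓧] {α τ : ℝ} {H : Measure 𝓧}
    {G : Ω → Measure 𝓧} (hG : IsGammaProcess G α τ H P) {A : Set 𝓧} (hA : MeasurableSet A)
    (hH : H A = 0) : ∀ᵐ ω ∂P, G ω A = 0 := by
  have h := hG.marginal A hA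
  refine ae_iff.2 ?_
  rw [h.measure_eq (p := fun x => ¬ x = 0) (measurableSet_singleton _).compl]
  change gammaLawENNReal _ _ _ = 0
  rw [Measure.real, hH, ENNReal.toReal_zero, mul_zero, gammaLawENNReal_zero]
  change Measure.dirac (0 : ℝ≥0∞) {0}ᶜ = 0
  rw [Measure.dirac_apply' _ (measurableSet_singleton _).compl]
  simp

/-- If the atom set `F` were finite, the unions of level-`N` cylinders through `F` would decrease to
`F`, which is H-null. At some level an H-positive cylinder would then miss `F`; but the process
charges that cylinder and, being atomic, has an atom in it. -/
theorem IsGammaProcess.ae_infinite_atomSet {Ω : Type u} [MeasurableSpace Ω] {P : Measure Ω}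
    {𝓧 : Type v} [MeasurableSpace 𝓧] [MeasurableSpace.CountablySeparated 𝓧] {α τ : ℝ}
    {H : Measure 𝓧} [IsProbabilityMeasure H] [NullSingletonClass H] (hα : 0 < α)
    {G : Ω → Measure 𝓧} (hG : IsGammaProcess G α τ H P) : ∀ᵐ ω ∂P, (atomSet (G ω)).Infinite := by
  classical
  have := MeasurableSpace.measurableSingletonClass_of_countablySeparated (α := 𝓧)
  obtain ⟨f, hf, hinj⟩ := MeasurableSpace.measurable_injection_nat_bool_of_countablySeparated 𝓧
  obtain ⟨w, X, -, -, hwX⟩ := hG.atomic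
  set C : (N : ℕ) → (Fin N → Bool) → Set 𝓧 := fun N p => {z | (fun i : Fin N => f z i) = p}
  have hCm : ∀ N p, MeasurableSet (C N p) := fun N p => by
    have : Measurable fun z => fun i : Fin N => f z i :=
      measurable_pi_lambda _ fun i => (measurable_pi_apply _).comp hf
    exact this (measurableSet_singleton p)
  -- There are only countably many cylinders, so one null set serves them all, even though the
  -- cylinder used below depends on `ω`.
  have hpos : ∀ᵐ ω ∂P, ∀ N p, H (C N p) ≠ 0 → 0 < G ω (C N p) := by
    refine ae_all_iff.2 fun N => ae_all_iff.2 fun p => ?_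
    by_cases h : H (C N p) = 0
    · simp [h]
    · filter_upwards [hG.ae_pos hα (hCm N p) h] with ω h' _ using h'
  filter_upwards [hwX, hpos] with ω h1 h2 hF
  set F := atomSet (G ω)
  set B : ℕ → Set 𝓧 := fun N => ⋃ y ∈ F, C N fun i => f y i
  have hBm : ∀ N, MeasurableSet (B N) := fun N =>
    hF.measurableSet_biUnion fun y _ => hCm N _
  have hBanti : Antitone B := fun M N hMN z hz => by
    obtain ⟨y, hy, hz⟩ := Set.mem_iUnion₂.1 hz
    refine Set.mem_iUnion₂.2 ⟨y, hy, funext fun i => ?_⟩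
    exact congrFun hz (Fin.castLE hMN i)
  have hBF : ⋂ N, B N ⊆ F := by
    intro z hz
    by_contra hzF
    have hne : ∀ y ∈ F, ∃ i, f z i ≠ f y i := fun y hy => by
      by_contra! h
      exact hzF (hinj (funext h) ▸ hy)
    choose! i hi using hne
    obtain ⟨M, hM⟩ := (hF.image i).bddAbove
    obtain ⟨y, hy, hzy⟩ := Set.mem_iUnion₂.1 (Set.mem_iInter.1 hz (M + 1))
    exact hi y hy (congrFun hzy ⟨i y, Nat.lt_succ_of_le (hM (Set.mem_image_of_mem i hy))⟩)
  have hlim := tendsto_measure_iInter_atTop (μ := H) (fun N => (hBm N).nullMeasurableSet) hBanti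
    ⟨0, measure_ne_top _ _⟩
  rw [measure_mono_null hBF (hF.measure_zero H)] at hlim
  obtain ⟨N, hN⟩ := (hlim.eventually_lt_const zero_lt_one).exists
  have hex : ∃ p, H (C N p ∩ (B N)ᶜ) ≠ 0 := by
    by_contra! h
    have h3 : H (B N)ᶜ = 0 := by
      refine measure_mono_null (fun z hz => ?_) (measure_iUnion_null h)
      exact Set.mem_iUnion.2 ⟨fun i => f z i, rfl, hz⟩
    have h4 := (prob_compl_eq_zero_iff (hBm N)).1 h3
    exact hN.ne h4
  obtain ⟨p, hp⟩ := hex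
  have hC : H (C N p) ≠ 0 := fun h => hp (measure_mono_null Set.inter_subset_left h)
  obtain ⟨z, hzC, hzB⟩ : (C N p ∩ (B N)ᶜ).Nonempty := by
    by_contra h
    rw [Set.not_nonempty_iff_eq_empty] at h
    exact hp (by rw [h, measure_empty])
  have h3 := h2 N p hC
  rw [h1, atomicMeasure_apply _ _ (hCm N p), pos_iff_ne_zero, ne_eq, ENNReal.tsum_eq_zero,
    not_forall] at h3
  obtain ⟨k, hk⟩ := h3
  simp only [ite_eq_right_iff, ENNReal.coe_eq_zero, Classical.not_imp] at hk
  have hXF : X k ω ∈ F := by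
    change X k ω ∈ atomSet (G ω)
    rw [h1, atomSet_atomicMeasure]
    exact ⟨k, hk.2, rfl⟩
  refine hzB (Set.mem_iUnion₂.2 ⟨X k ω, hXF, ?_⟩)
  exact hzC.trans (show (fun i : Fin N => f (X k ω) i) = p from hk.1).symm

/-! ### The posterior law as an independent superposition. -/

/-- Applied to `G₀` with `c = τ / (τ + φ)`, this supplies Γ(α, τ + φ, H) without a separate
construction of gamma processes. -/
theorem IsGammaProcess.const_smul {Ω : Type u} [MeasurableSpace Ω] {P : Measure Ω}
    {𝓧 : Type v} [MeasurableSpace 𝓧] {α τ : ℝ} {H : Measure 𝓧} (hα : 0 < α) (hτ : 0 < τ)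
    {G : Ω → Measure 𝓧} (hG : IsGammaProcess G α τ H P) {c : ℝ≥0} (hc : 0 < c) :
    IsGammaProcess (fun ω => (c : ℝ≥0∞) • G ω) α (τ / c) H P where
  measurable := Measure.measurable_of_measurable_coe _ fun A hA =>
    ((Measure.measurable_coe hA).comp hG.measurable).const_mul _
  atomic := by
    classical
    obtain ⟨w, X, hw, hX, h⟩ := hG.atomic
    refine ⟨fun k ω => c * w k ω, X, fun k => (hw k).const_mul c, hX, ?_⟩
    filter_upwards [h] with ω h
    ext A hA
    rw [h, Measure.smul_apply, atomicMeasure_apply _ _ hA, atomicMeasure_apply _ _ hA,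
      smul_eq_mul, ← ENNReal.tsum_mul_left]
    simp [mul_ite]
  indep n A hA hd := (hG.indep n A hA hd).comp (fun _ x => (c : ℝ≥0∞) * x) fun _ => by fun_prop
  marginal A hA := by
    have h := hG.marginal A hA
    have h2 := gammaLawENNReal_map_const_mul (a := α * H.real A) (r := τ)
      (mul_nonneg hα.le measureReal_nonneg) hτ hc
    change HasLaw _ (gammaLawENNReal _ _) P
    rw [← h2]
    have h3 : HasLaw (fun g => (c : ℝ≥0∞) * g) ((gammaLawENNReal (α * H.real A) τ).map
        ((c : ℝ≥0∞) * ·)) (gammaLawENNReal (α * H.real A) τ) := ⟨by fun_prop, rfl⟩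
    exact h3.comp h

theorem IsGammaProcess.comp_measurePreserving {Ω Ω' : Type u} [MeasurableSpace Ω]
    [MeasurableSpace Ω'] {P : Measure Ω} [IsProbabilityMeasure P] {Q : Measure Ω'}
    [IsProbabilityMeasure Q] {𝓧 : Type v} [MeasurableSpace 𝓧] {α τ : ℝ} {H : Measure 𝓧}
    {G : Ω → Measure 𝓧} (hG : IsGammaProcess G α τ H P) {f : Ω' → Ω}
    (hf : MeasurePreserving f Q P) : IsGammaProcess (fun ω => G (f ω)) α τ H Q where
  measurable := hG.measurable.comp hf.measurable
  atomic := by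
    obtain ⟨w, X, hw, hX, h⟩ := hG.atomic
    exact ⟨fun k ω => w k (f ω), fun k ω => X k (f ω), fun k => (hw k).comp hf.measurable,
      fun k => (hX k).comp hf.measurable, hf.quasiMeasurePreserving.ae h⟩
  indep n A hA hd := by
    have h := hG.hasLaw_pi hA hd
    refine (iIndepFun_iff_hasLaw_pi_pi fun i => (hG.marginal (A i) (hA i)).comp hf.hasLaw).2 ?_
    exact h.2.comp hf.hasLaw
  marginal A hA := (hG.marginal A hA).comp hf.hasLaw

/-- The posterior law: an independent superposition of a gamma process and gamma masses. -/
theorem isGammaPosterior_map_add {Ω : Type u} [MeasurableSpace Ω] {P : Measure Ω}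
    [IsProbabilityMeasure P] {𝓧 : Type v} [MeasurableSpace 𝓧]
    [MeasurableSpace.CountablySeparated 𝓧] {α r : ℝ} (hα : 0 < α) (hr : 0 < r)
    {H : Measure 𝓧} [IsProbabilityMeasure H] [NullSingletonClass H]
    {G : Ω → Measure 𝓧} (hG : IsGammaProcess G α r H P) (n : ℕ → ℕ) (x : ℕ → 𝓧)
    (hn : {k | 0 < n k}.Finite) :
    IsGammaPosterior.{u, v} (((P.map G).prod (gammaAtomLaw r n x)).map fun p => p.1 + p.2)
      α r H n x := by
  have := MeasurableSpace.measurableSingletonClass_of_countablySeparated (α := 𝓧)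
  have hp (k : ℕ) : IsProbabilityMeasure (gammaLaw (n k) r) :=
    isProbabilityMeasure_gammaLaw (n k).cast_nonneg hr
  -- The lift puts the space of weights in the universe of `Ω`, as the definition of the posterior
  -- demands of its probability space.
  set μ : Measure (ULift.{u} (ℕ → ℝ≥0)) :=
    (Measure.infinitePi fun k => gammaLaw (n k) r).map ULift.up with hμ
  have : IsProbabilityMeasure μ := Measure.isProbabilityMeasure_map measurable_up.aemeasurable
  have hdown : MeasurePreserving ULift.down μ (Measure.infinitePi fun k => gammaLaw (n k) r) := by
    refine ⟨measurable_down, ?_⟩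
    rw [hμ, Measure.map_map measurable_down measurable_up]
    exact Measure.map_id
  have hfst : MeasurePreserving Prod.fst (P.prod μ) P := measurePreserving_fst
  have hsnd : MeasurePreserving (fun p : Ω × ULift.{u} (ℕ → ℝ≥0) => p.2.down) (P.prod μ)
      (Measure.infinitePi fun k => gammaLaw (n k) r) := hdown.comp measurePreserving_snd
  have hG' := hG.comp_measurePreserving hfst
  have hlaw (k : ℕ) : HasLaw (fun p : Ω × ULift.{u} (ℕ → ℝ≥0) => p.2.down k)
      (gammaLaw (n k) r) (P.prod μ) :=
    ((measurePreserving_eval_infinitePi (fun k => gammaLaw (n k) r) k).comp hsnd).hasLaw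
  have hfinS : (atomSet (atomicMeasure (fun k => (n k : ℝ≥0)) x)).Finite := by
    rw [atomSet_atomicMeasure]
    refine (hn.subset fun k hk => Nat.pos_of_ne_zero fun h => ?_).image x
    exact (show (n k : ℝ≥0) ≠ 0 from hk) (by simp [h])
  have hF : Measurable fun w : ℕ → ℝ≥0 => atomicMeasure w x :=
    measurable_atomicMeasure (fun k => by fun_prop) fun k => measurable_const
  refine ⟨Ω × ULift.{u} (ℕ → ℝ≥0), inferInstance, P.prod μ, inferInstance, fun p => G p.1,
    fun k p => p.2.down k, hG', hlaw, ?_, ?_, ?_, ?_, hfinS, ?_⟩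
  · exact (iIndepFun_iff_hasLaw_Pi_infinitePi hlaw hsnd.measurable.aemeasurable).2 hsnd.hasLaw
  · exact indepFun_prod hG.measurable measurable_down
  · refine ⟨((hG.measurable.comp measurable_fst).add (hF.comp hsnd.measurable)).aemeasurable, ?_⟩
    have hadd : Measurable fun p : Measure 𝓧 × Measure 𝓧 => p.1 + p.2 := measurable_add
    have h2 := Measure.map_prod_map P μ hG.measurable (hF.comp measurable_down)
    rw [← Measure.map_map hF measurable_down, hdown.map_eq] at h2
    rw [gammaAtomLaw, h2, Measure.map_map hadd
      (hG.measurable.prodMap (hF.comp measurable_down))]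
    rfl
  · have h := hG'.marginal Set.univ .univ
    rwa [probReal_univ, mul_one] at h
  · have h1 : ∀ᵐ p ∂P.prod μ, ∀ k, p.2.down k = 0 ↔ n k = 0 := by
      refine ae_all_iff.2 fun k => ?_
      rcases Nat.eq_zero_or_pos (n k) with h | h
      · refine ae_iff.2 ?_
        simp only [h, iff_true]
        rw [(hlaw k).measure_eq (p := fun x => ¬ x = 0) (measurableSet_singleton _).compl, h,
          Nat.cast_zero, gammaLaw_zero]
        change Measure.dirac (0 : ℝ≥0) {0}ᶜ = 0
        rw [Measure.dirac_apply' _ (measurableSet_singleton _).compl]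
        simp
      · refine ae_iff.2 ?_
        simp only [h.ne', iff_false, not_not]
        rw [(hlaw k).measure_eq (p := fun x => x = 0) (measurableSet_singleton _)]
        exact gammaLaw_singleton_zero (Nat.cast_pos.2 h)
    have h2 : ∀ᵐ p ∂P.prod μ, ∀ y ∈ atomSet (atomicMeasure (fun k => (n k : ℝ≥0)) x),
        G p.1 {y} = 0 :=
      (ae_ball_iff hfinS.countable).2 fun y _ =>
        hG'.ae_eq_zero (measurableSet_singleton y) (measure_singleton y)
    filter_upwards [h1, h2, hG'.ae_infinite_atomSet hα] with p h3 h4 h5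
    refine ⟨?_, h5, ?_⟩
    · rw [atomSet_atomicMeasure, atomSet_atomicMeasure]
      congr 1
      ext k
      simp [h3 k]
    · exact Set.disjoint_left.2 fun y hy hy' => hy.ne' (h4 y hy')

/-! ### Evaluations on disjoint sets determine the law. -/

open Classical in
theorem atomicMeasure_natCast_apply {𝓧 : Type v} [MeasurableSpace 𝓧] {n : ℕ → ℕ} (x : ℕ → 𝓧)
    (hn : {k | 0 < n k}.Finite) {A : Set 𝓧} (hA : MeasurableSet A) :
    atomicMeasure (fun k => (n k : ℝ≥0)) x A =
      ((∑ k ∈ hn.toFinset, if x k ∈ A then n k else 0 : ℕ) : ℝ≥0∞) := by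
  rw [atomicMeasure_apply _ _ hA, tsum_eq_sum (s := hn.toFinset)]
  · push_cast
    exact Finset.sum_congr rfl fun k _ => by split_ifs <;> simp
  · intro k hk
    have : n k = 0 := by simpa using hk
    simp [this]

/-- Evaluation of a measure on a family of sets. -/
def evalSets {𝓧 : Type v} [MeasurableSpace 𝓧] {J : Type*} (A : J → Set 𝓧) (μ : Measure 𝓧) :
    J → ℝ≥0∞ := fun j => μ (A j)

theorem measurable_evalSets {𝓧 : Type v} [MeasurableSpace 𝓧] {J : Type*} {A : J → Set 𝓧}
    (hA : ∀ j, MeasurableSet (A j)) : Measurable (evalSets A) :=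
  measurable_pi_lambda _ fun j => Measure.measurable_coe (hA j)

/-- Gamma additivity within each set: the shapes of the weights located in `A j` sum to the count
there. Only the block counts `m` survive, just as in the conjugacy formula. -/
theorem map_evalSets_gammaAtomLaw {𝓧 : Type v} [MeasurableSpace 𝓧] {r : ℝ} (hr : 0 < r)
    {n : ℕ → ℕ} (x : ℕ → 𝓧) (hn : {k | 0 < n k}.Finite) {J : Type*} [Fintype J] {A : J → Set 𝓧}
    (hA : ∀ j, MeasurableSet (A j)) (hd : Pairwise (Function.onFun Disjoint A)) {m : J → ℕ}
    (hm : ∀ j, atomicMeasure (fun k => (n k : ℝ≥0)) x (A j) = m j) :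
    (gammaAtomLaw r n x).map (evalSets A) = Measure.pi fun j => gammaLawENNReal (m j) r := by
  classical
  have hp (k : ℕ) : IsProbabilityMeasure (gammaLaw (n k) r) :=
    isProbabilityMeasure_gammaLaw (n k).cast_nonneg hr
  set Q := Measure.infinitePi fun k => gammaLaw (n k) r
  have hF : Measurable fun w : ℕ → ℝ≥0 => atomicMeasure w x :=
    measurable_atomicMeasure (fun k => by fun_prop) fun k => measurable_const
  have heval (k : ℕ) : HasLaw (fun w : ℕ → ℝ≥0 => w k) (gammaLaw (n k) r) Q :=
    (measurePreserving_eval_infinitePi (fun k => gammaLaw (n k) r) k).hasLaw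
  have hcoe (k : ℕ) : HasLaw ((↑) : ℝ≥0 → ℝ≥0∞) (gammaLawENNReal (n k) r) (gammaLaw (n k) r) :=
    ⟨by fun_prop, rfl⟩
  have h := hasLaw_block_sum (Q := Q) (fun a : ℝ => 0 ≤ a) le_rfl (fun _ _ => add_nonneg)
    (fun a => gammaLawENNReal a r) (fun a ha => isProbabilityMeasure_gammaLawENNReal ha hr)
    (gammaLawENNReal_zero r) (fun a b ha hb => gammaLawENNReal_conv ha hb hr)
    (fun k (w : ℕ → ℝ≥0) => (w k : ℝ≥0∞)) (fun k => (n k : ℝ)) (fun k => (n k).cast_nonneg)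
    (fun k => by fun_prop) (fun k => (hcoe k).comp (heval k))
    (iIndepFun_infinitePi (X := fun _ => ((↑) : ℝ≥0 → ℝ≥0∞)) fun k => by fun_prop)
    (fun k j => x k ∈ A j) (fun k i j hi hj => by
      by_contra hij
      exact Set.disjoint_left.1 (hd hij) hi hj) hn.toFinset
  have hsum (j : J) : (∑ k ∈ hn.toFinset, if x k ∈ A j then (n k : ℝ) else 0) = m j := by
    have h1 := (atomicMeasure_natCast_apply x hn (hA j)).symm.trans (hm j)
    have h2 : (∑ k ∈ hn.toFinset, if x k ∈ A j then n k else 0) = m j := by exact_mod_cast h1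
    rw [← h2]
    push_cast
    rfl
  simp only [hsum] at h
  rw [gammaAtomLaw, Measure.map_map (measurable_evalSets hA) hF, ← h.map_eq]
  refine Measure.map_congr ?_
  -- Indices with zero count carry almost surely no weight, which reduces the series to the finite
  -- sum over positive counts.
  have h0 : ∀ᵐ w ∂Q, ∀ k, n k = 0 → w k = 0 := by
    refine ae_all_iff.2 fun k => ?_
    by_cases hk : n k = 0
    · simp only [hk, true_imp_iff]
      refine ae_iff.2 ?_
      rw [(heval k).measure_eq (p := fun x => ¬ x = 0) (measurableSet_singleton _).compl, hk,
        Nat.cast_zero, gammaLaw_zero]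
      change Measure.dirac (0 : ℝ≥0) {0}ᶜ = 0
      rw [Measure.dirac_apply' _ (measurableSet_singleton _).compl]
      simp
    · simp [hk]
  filter_upwards [h0] with w hw
  ext j
  change atomicMeasure w x (A j) = _
  rw [atomicMeasure_apply _ _ (hA j), tsum_eq_sum (s := hn.toFinset)]
  intro k hk
  have : n k = 0 := by simpa using hk
  simp [hw k this]

theorem map_evalSets_posterior {Ω : Type u} [MeasurableSpace Ω] {P : Measure Ω}
    [IsProbabilityMeasure P] {𝓧 : Type v} [MeasurableSpace 𝓧] {α r : ℝ} (hα : 0 < α) (hr : 0 < r)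
    {H : Measure 𝓧} {G : Ω → Measure 𝓧} (hG : IsGammaProcess G α r H P)
    {n : ℕ → ℕ} (x : ℕ → 𝓧) (hn : {k | 0 < n k}.Finite) {J : Type*} [Fintype J] {A : J → Set 𝓧}
    (hA : ∀ j, MeasurableSet (A j)) (hd : Pairwise (Function.onFun Disjoint A)) {m : J → ℕ}
    (hm : ∀ j, atomicMeasure (fun k => (n k : ℝ≥0)) x (A j) = m j) :
    (((P.map G).prod (gammaAtomLaw r n x)).map fun p => p.1 + p.2).map (evalSets A) =
      Measure.pi fun j => gammaLawENNReal (α * H.real (A j) + m j) r := by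
  have ha : ∀ j, 0 ≤ α * H.real (A j) := fun j => mul_nonneg hα.le measureReal_nonneg
  have := isProbabilityMeasure_gammaAtomLaw hr n x
  have : IsProbabilityMeasure (P.map G) :=
    Measure.isProbabilityMeasure_map hG.measurable.aemeasurable
  have := fun j => isProbabilityMeasure_gammaLawENNReal (ha j) hr
  have := fun j => isProbabilityMeasure_gammaLawENNReal (m j).cast_nonneg hr
  have hE := measurable_evalSets hA
  have h1 : (evalSets A ∘ fun p : Measure 𝓧 × Measure 𝓧 => p.1 + p.2) =
      (fun q => q.1 + q.2) ∘ Prod.map (evalSets A) (evalSets A) := rfl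
  rw [Measure.map_map hE measurable_add, h1, ← Measure.map_map measurable_add (hE.prodMap hE),
    ← Measure.map_prod_map _ _ hE hE, map_evalSets_gammaAtomLaw hr x hn hA hd hm,
    Measure.map_map hE hG.measurable]
  have h2 := (hG.hasLaw_pi hA hd).2.map_eq
  have h3 := pi_conv_pi (fun j => gammaLawENNReal (α * H.real (A j)) r)
    fun j => gammaLawENNReal (m j) r
  simp only [fun j => gammaLawENNReal_conv (ha j) (m j).cast_nonneg hr] at h3
  rw [← h3, ← h2]
  rfl

/-- A finite measure on pairs of measures is determined by the joint laws of the evaluations on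
finite families of disjoint measurable sets. -/
theorem measure_prod_measure_ext {𝓧 : Type v} [MeasurableSpace 𝓧]
    {ρ₁ ρ₂ : Measure (Measure 𝓧 × Measure 𝓧)} [IsFiniteMeasure ρ₁] [IsFiniteMeasure ρ₂]
    (h : ∀ (J : Type v) [Fintype J] (A : J → Set 𝓧), (∀ j, MeasurableSet (A j)) →
      Pairwise (Function.onFun Disjoint A) →
      ρ₁.map (Prod.map (evalSets A) (evalSets A)) = ρ₂.map (Prod.map (evalSets A) (evalSets A))) :
    ρ₁ = ρ₂ := by
  classical
  set Φ : Measure 𝓧 × Measure 𝓧 → {A : Set 𝓧 // MeasurableSet A} → ℝ≥0∞ × ℝ≥0∞ :=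
    fun p A => (p.1 A, p.2 A) with hΦ
  have hΦm : Measurable Φ := measurable_pi_lambda _ fun A =>
    ((Measure.measurable_coe A.2).comp measurable_fst).prodMk
      ((Measure.measurable_coe A.2).comp measurable_snd)
  have key : ρ₁.map Φ = ρ₂.map Φ := by
    refine IsProjectiveLimit.unique (P := fun I => (ρ₁.map Φ).map I.restrict) (fun I => rfl)
      fun I => ?_
    -- The cells of the finite partition generated by the sets in `I`; each set is a disjoint union
    -- of cells, so evaluations on cells determine those on `I`.
    set A : (I → Bool) → Set 𝓧 := fun b => {z | (fun s : I => decide (z ∈ s.1.1)) = b}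
    have hA : ∀ b, MeasurableSet (A b) := fun b => by
      have : Measurable fun z => fun s : I => decide (z ∈ s.1.1) :=
        measurable_pi_lambda _ fun s => measurable_to_bool (by
          convert s.1.2 using 1
          ext z
          simp)
      exact this (measurableSet_singleton b)
    have hd : Pairwise (Function.onFun Disjoint A) := fun b b' hbb =>
      Set.disjoint_left.2 fun z hz hz' => hbb (hz.symm.trans hz')
    have hs (s : I) : s.1.1 = ⋃ b ∈ Finset.univ.filter fun b : I → Bool => b s = true, A b := by
      ext z
      simp only [Finset.mem_filter, Finset.mem_univ, true_and, Set.mem_iUnion, exists_prop]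
      constructor
      · intro hz
        exact ⟨fun s : I => decide (z ∈ s.1.1), by simpa using hz, rfl⟩
      · rintro ⟨b, hb, rfl⟩
        simpa using hb
    have hsum (μ : Measure 𝓧) (s : I) : μ s.1.1 =
        ∑ b ∈ Finset.univ.filter fun b : I → Bool => b s = true, evalSets A μ b := by
      conv_lhs => rw [hs s]
      exact measure_biUnion_finset (fun b _ b' _ hbb => hd hbb) fun b _ => hA b
    set R : ((I → Bool) → ℝ≥0∞) × ((I → Bool) → ℝ≥0∞) → I → ℝ≥0∞ × ℝ≥0∞ := fun v s =>
      (∑ b ∈ Finset.univ.filter fun b : I → Bool => b s = true, v.1 b,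
        ∑ b ∈ Finset.univ.filter fun b : I → Bool => b s = true, v.2 b)
    have hR : Measurable R := measurable_pi_lambda _ fun s => by fun_prop
    have hfac : I.restrict ∘ Φ = R ∘ Prod.map (evalSets A) (evalSets A) := by
      ext1 p
      funext s
      exact Prod.ext (hsum p.1 s) (hsum p.2 s)
    have hE := (measurable_evalSets hA).prodMap (measurable_evalSets hA)
    change (ρ₂.map Φ).map I.restrict = (ρ₁.map Φ).map I.restrict
    rw [Measure.map_map (Finset.measurable_restrict I) hΦm,
      Measure.map_map (Finset.measurable_restrict I) hΦm, hfac, ← Measure.map_map hR hE,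
      ← Measure.map_map hR hE, h _ A hA hd]
  have hle : (inferInstance : MeasurableSpace (Measure 𝓧 × Measure 𝓧)) ≤
      MeasurableSpace.comap Φ inferInstance := by
    have h1 : Measurable[MeasurableSpace.comap Φ inferInstance]
        (Prod.fst : Measure 𝓧 × Measure 𝓧 → Measure 𝓧) := by
      refine @Measure.measurable_of_measurable_coe _ _ _ (MeasurableSpace.comap Φ inferInstance) _
        fun s hs => ?_
      exact (measurable_fst.comp (measurable_pi_apply (⟨s, hs⟩ : {A : Set 𝓧 // MeasurableSet A}))).comp
        (comap_measurable Φ)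
    have h2 : Measurable[MeasurableSpace.comap Φ inferInstance]
        (Prod.snd : Measure 𝓧 × Measure 𝓧 → Measure 𝓧) := by
      refine @Measure.measurable_of_measurable_coe _ _ _ (MeasurableSpace.comap Φ inferInstance) _
        fun s hs => ?_
      exact (measurable_snd.comp (measurable_pi_apply (⟨s, hs⟩ : {A : Set 𝓧 // MeasurableSet A}))).comp
        (comap_measurable Φ)
    exact sup_le h1.comap_le h2.comap_le
  ext t ht
  obtain ⟨t', ht', rfl⟩ := hle t ht
  rw [← Measure.map_apply hΦm ht', key, Measure.map_apply hΦm ht']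

/-! ### The posterior kernel and the conclusion. -/

/-- The posterior kernel: `m ↦` law of `G + ∑ₖ w'ₖ δ_{xₖ}` for `m = ∑ₖ nₖ δ_{xₖ}`. -/
noncomputable def gammaPosteriorKernel {𝓧 : Type v} [MeasurableSpace 𝓧]
    [MeasurableSpace.CountablySeparated 𝓧] (x₀ : 𝓧) (r : ℝ) (μ : Measure (Measure 𝓧)) :
    Kernel (Measure 𝓧) (Measure 𝓧) :=
  ((Kernel.const (Measure 𝓧) μ) ×ₖ gammaAtomKernel x₀ r).map fun p => p.1 + p.2

section Posterior

variable {𝓧 : Type v} [MeasurableSpace 𝓧] [MeasurableSpace.CountablySeparated 𝓧]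

theorem isMarkovKernel_gammaPosteriorKernel (x₀ : 𝓧) {r : ℝ} (hr : 0 < r)
    (μ : Measure (Measure 𝓧)) [IsProbabilityMeasure μ] :
    IsMarkovKernel (gammaPosteriorKernel x₀ r μ) := by
  have := isMarkovKernel_gammaAtomKernel x₀ hr
  exact Kernel.IsMarkovKernel.map _ measurable_add

theorem gammaPosteriorKernel_apply (x₀ : 𝓧) {r : ℝ} (hr : 0 < r) (μ : Measure (Measure 𝓧))
    [IsProbabilityMeasure μ] (x : ℕ → 𝓧) (n : ℕ → ℕ) (hn : {k | 0 < n k}.Finite) :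
    gammaPosteriorKernel x₀ r μ (atomicMeasure (fun k => (n k : ℝ≥0)) x) =
      (μ.prod (gammaAtomLaw r n x)).map fun p => p.1 + p.2 := by
  have := isMarkovKernel_gammaAtomKernel x₀ hr
  rw [gammaPosteriorKernel, Kernel.map_apply _ measurable_add, Kernel.prod_apply,
    Kernel.const_apply, gammaAtomKernel_apply x₀ hr x n hn]

/-- The joint law of `U` and `G₀` is compared with the kernel's on rectangles of evaluations over
disjoint sets. There both sides depend on `U` only through its integer counts, and conjugacy and
superposition give the same product of gamma laws. -/
theorem hasCondDistrib_gammaPosteriorKernel {Ω : Type u} [MeasurableSpace Ω] {P : Measure Ω}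
    [IsProbabilityMeasure P] {H : Measure 𝓧}
    {α τ φ : ℝ} (hα : 0 < α) (hτ : 0 < τ) (hφ : 0 < φ)
    {G₀ G U : Ω → Measure 𝓧} {w : ℕ → Ω → ℝ≥0} {X : ℕ → Ω → 𝓧} {u : ℕ → Ω → ℕ}
    (hw : ∀ k, Measurable (w k)) (hX : ∀ k, Measurable (X k)) (hU : Measurable U)
    (hG₀ : IsGammaProcess G₀ α τ H P)
    (hG₀_eq : ∀ᵐ ω ∂P, G₀ ω = atomicMeasure (w · ω) (X · ω))
    (hu : IsCondPoisson u w X φ P)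
    (hU_eq : ∀ᵐ ω ∂P, U ω = atomicMeasure (fun k => (u k ω : ℝ≥0)) (X · ω))
    (hufin : ∀ᵐ ω ∂P, {k | 0 < u k ω}.Finite)
    (hG : IsGammaProcess G α (τ + φ) H P) (x₀ : 𝓧) :
    HasCondDistrib G₀ U (gammaPosteriorKernel x₀ (τ + φ) (P.map G)) P := by
  classical
  have hr := add_pos hτ hφ
  have hGm := hG₀.measurable
  have : IsProbabilityMeasure (P.map G) :=
    Measure.isProbabilityMeasure_map hG.measurable.aemeasurable
  have : IsProbabilityMeasure (P.map U) := Measure.isProbabilityMeasure_map hU.aemeasurable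
  have := isMarkovKernel_gammaPosteriorKernel x₀ hr (P.map G)
  set κ := gammaPosteriorKernel x₀ (τ + φ) (P.map G)
  have : IsProbabilityMeasure (P.map fun ω => (U ω, G₀ ω)) :=
    Measure.isProbabilityMeasure_map (hU.prodMk hGm).aemeasurable
  refine ⟨(hU.prodMk hGm).aemeasurable, measure_prod_measure_ext fun J _ A hA hd => ?_⟩
  have hE := measurable_evalSets hA
  have hEE := hE.prodMap hE
  refine Measure.ext_prod fun {R T} hR hT => ?_
  rw [Measure.map_apply hEE (hR.prod hT), Measure.map_apply hEE (hR.prod hT),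
    Measure.map_apply (hU.prodMk hGm) (hEE (hR.prod hT)),
    show Prod.map (evalSets A) (evalSets A) ⁻¹' R ×ˢ T = (evalSets A ⁻¹' R) ×ˢ (evalSets A ⁻¹' T)
      from rfl, Measure.compProd_apply_prod (hE hR) (hE hT),
    setLIntegral_map (hE hR) (Kernel.measurable_coe _ (hE hT)) hU]
  -- `U (A j)` is almost surely a natural number, so the floor merely changes its type. Conditioning
  -- then takes place on a countable space, where singletons suffice.
  set N : Ω → J → ℕ := fun ω j => ⌊(U ω (A j)).toNNReal⌋₊
  have hN : Measurable N := measurable_pi_lambda _ fun j =>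
    Nat.measurable_floor.comp ((Measure.measurable_coe (hA j)).comp hU).ennreal_toNNReal
  have hNU : ∀ᵐ ω ∂P, ∀ j, U ω (A j) = N ω j := by
    filter_upwards [hU_eq, hufin] with ω h1 h2 j
    have h3 := atomicMeasure_natCast_apply (X · ω) h2 (hA j)
    rw [← h1] at h3
    simp only [N]
    rw [h3, ENNReal.toNNReal_natCast, Nat.floor_natCast]
  set q : (J → ℕ) → ℝ≥0∞ := fun n =>
    Measure.pi (fun j => gammaLawENNReal (α * H.real (A j) + n j) (τ + φ)) T
  have hκ : ∀ᵐ ω ∂P, κ (U ω) (evalSets A ⁻¹' T) = q (N ω) := by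
    filter_upwards [hU_eq, hufin, hNU] with ω h1 h2 h3
    rw [h1] at h3
    rw [h1, gammaPosteriorKernel_apply x₀ hr _ _ _ h2, ← Measure.map_apply hE hT,
      map_evalSets_posterior hα hr hG _ h2 hA hd h3]
  have hGT : MeasurableSet ((fun ω => evalSets A (G₀ ω)) ⁻¹' T) := (hE.comp hGm) hT
  have hμ : (P.restrict ((fun ω => evalSets A (G₀ ω)) ⁻¹' T)).map N = (P.map N).withDensity q := by
    refine Measure.ext_of_singleton fun n => ?_
    have hn := hN (measurableSet_singleton n)
    have hNn : ∀ S : Set Ω, P (N ⁻¹' {n} ∩ S) = P ({ω | ∀ j, U ω (A j) = n j} ∩ S) := fun S => by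
      refine measure_congr ?_
      filter_upwards [hNU] with ω h
      refine propext (and_congr_left fun _ => ?_)
      change N ω = n ↔ ∀ j, U ω (A j) = n j
      rw [funext_iff]
      exact forall_congr' fun j => by rw [h j, Nat.cast_inj]
    rw [Measure.map_apply hN (measurableSet_singleton n), Measure.restrict_apply hn,
      withDensity_apply _ (measurableSet_singleton n), lintegral_singleton,
      Measure.map_apply hN (measurableSet_singleton n), hNn, mul_comm]
    have h1 := hNn Set.univ
    rw [Set.inter_univ, Set.inter_univ] at h1
    rw [h1]
    exact measure_counts_gamma hα hτ hφ hw hX hG₀ hG₀_eq hu hU_eq hA hd n hT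
  have hRN : ∀ᵐ ω ∂P, evalSets A (U ω) ∈ R ↔ N ω ∈ {n : J → ℕ | (fun j => (n j : ℝ≥0∞)) ∈ R} := by
    filter_upwards [hNU] with ω h
    rw [show evalSets A (U ω) = fun j => (N ω j : ℝ≥0∞) from funext h]
  have hR' : MeasurableSet {n : J → ℕ | (fun j => (n j : ℝ≥0∞)) ∈ R} := .of_discrete
  have h2 := congrArg (fun μ => μ {n : J → ℕ | (fun j => (n j : ℝ≥0∞)) ∈ R}) hμ
  rw [Measure.map_apply hN hR', Measure.restrict_apply (hN hR'), withDensity_apply _ hR',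
    setLIntegral_map hR' (measurable_of_countable q) hN] at h2
  have e1 : P ((fun ω => (U ω, G₀ ω)) ⁻¹' (evalSets A ⁻¹' R) ×ˢ (evalSets A ⁻¹' T)) =
      P (N ⁻¹' {n : J → ℕ | (fun j => (n j : ℝ≥0∞)) ∈ R} ∩
        (fun ω => evalSets A (G₀ ω)) ⁻¹' T) := by
    refine measure_congr ?_
    filter_upwards [hRN] with ω h
    exact propext (and_congr_left fun _ => h)
  rw [e1, h2, setLIntegral_congr (show U ⁻¹' (evalSets A ⁻¹' R) =ᵐ[P]
    N ⁻¹' {n : J → ℕ | (fun j => (n j : ℝ≥0∞)) ∈ R} from hRN.mono fun ω h => propext h)]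
  exact lintegral_congr_ae (ae_restrict_of_ae (hκ.mono fun ω h => h.symm))

end Posterior

theorem mainTheorem6 {Ω : Type u} [MeasurableSpace Ω] (P : Measure Ω) [IsProbabilityMeasure P]
    {𝓧 : Type v} [MeasurableSpace 𝓧] [MeasurableSpace.CountablySeparated 𝓧]
    (H : Measure 𝓧) [IsProbabilityMeasure H] [NullSingletonClass H]
    (α τ φ : ℝ) (hα : 0 < α) (hτ : 0 < τ) (hφ : 0 < φ)
    (G₀ U : Ω → Measure 𝓧) (w : ℕ → Ω → ℝ≥0) (X : ℕ → Ω → 𝓧) (u : ℕ → Ω → ℕ)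
    (hw : ∀ k, Measurable (w k)) (hX : ∀ k, Measurable (X k)) (hU : Measurable U)
    (hG₀ : IsGammaProcess G₀ α τ H P)
    (hG₀_eq : ∀ᵐ ω ∂P, G₀ ω = atomicMeasure (w · ω) (X · ω))
    (hu : IsCondPoisson u w X φ P)
    (hU_eq : ∀ᵐ ω ∂P, U ω = atomicMeasure (fun k => (u k ω : ℝ≥0)) (X · ω)) :
    ∃ κ : Kernel (Measure 𝓧) (Measure 𝓧), IsMarkovKernel κ ∧
      HasCondDistrib G₀ U κ P ∧
      ∀ᵐ ω ∂P, {k | 0 < u k ω}.Finite ∧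
        IsGammaPosterior.{u, v} (κ (U ω)) α (τ + φ) H (u · ω) (X · ω) := by
  have hr := add_pos hτ hφ
  obtain ⟨ω₀⟩ : Nonempty Ω := nonempty_of_isProbabilityMeasure P
  -- Multiplication by `c` divides the inverse scale by `c`, and `τ / c = τ + φ`.
  set c : ℝ≥0 := (τ / (τ + φ)).toNNReal with hc
  have hc' : (c : ℝ) = τ / (τ + φ) := Real.coe_toNNReal _ (div_pos hτ hr).le
  have hcpos : 0 < c := Real.toNNReal_pos.2 (div_pos hτ hr)
  have hG := hG₀.const_smul hα hτ hcpos
  rw [hc', div_div_cancel₀ hτ.ne'] at hG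
  have hufin := IsCondPoisson.ae_finite hw hX hU hG₀.measurable hG₀_eq hu hU_eq hG₀.ae_univ_ne_top
  have : IsProbabilityMeasure (P.map fun ω => (c : ℝ≥0∞) • G₀ ω) :=
    Measure.isProbabilityMeasure_map hG.measurable.aemeasurable
  refine ⟨gammaPosteriorKernel (X 0 ω₀) (τ + φ) (P.map fun ω => (c : ℝ≥0∞) • G₀ ω),
    isMarkovKernel_gammaPosteriorKernel _ hr _,
    hasCondDistrib_gammaPosteriorKernel hα hτ hφ hw hX hU hG₀ hG₀_eq hu hU_eq hufin hG _, ?_⟩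
  filter_upwards [hufin, hU_eq] with ω h1 h2
  refine ⟨h1, ?_⟩
  rw [h2, gammaPosteriorKernel_apply _ hr _ _ _ h1]
  exact isGammaPosterior_map_add hα hr hG _ _ h1
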